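/- Work over $\mathbb{C}$. Let $r\ge 1$, let $\mathbf n=(n_1,\dots,n_r)$ and $\mathbf d=(d_1,\dots,d_r)$ be $r$-tuples of positive integers with $n_1\le\dots\le n_r$, put $d:=\min\{d_1,\dots,d_r\}$ and assume $d\ge 2$. Let $SV^{\mathbf n}_{\mathbf d}\subset\mathbb{P}^N$, $N=\prod_{i=1}^r\binom{n_i+d_i}{d_i}-1$, be the Segre-Veronese variety, that is, the product $\mathbb{P}^{n_1}\times\dots\times\mathbb{P}^{n_r}$ embedded by the complete linear system $|\mathcal{O}(d_1,\dots,d_r)|$. For a smooth point $p$ of a variety $X\subset\mathbb{P}^N$ and $s\ge 0$, let $T^s_pX\subset\mathbb{P}^N$ denote the $s$-osculating space, that is, the projective closure of the affine space through $p$ whose direction is spanned by the partial derivatives at $0$ of orders $1,\dots,s$ of a local holomorphic parametrization $\phi$ of $X$ with $\phi(0)=p$; thus $T^1_pX$ is the tangent space $T_pX$. Let $p_0,\dots,p_{n_1}\in SV^{\mathbf n}_{\mathbf d}$ be general points (i.e. let $(p_0,\dots,p_{n_1})$ lie in a suitable dense Zariski open subset of $(SV^{\mathbf n}_{\mathbf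 d})^{n_1+1}$) and let $$T=\left\langle T^{d-1}_{p_0}SV^{\mathbf n}_{\mathbf d},\dots,T^{d-1}_{p_{n_1}}SV^{\mathbf n}_{\mathbf d}\right\rangle .$$ Then a general hyperplane $H\subset\mathbb{P}^N$ containing $T$ (i.e. any $H$ in a suitable dense Zariski open subset, depending on $p_0,\dots,p_{n_1}$, of the linear space of hyperplanes containing $T$, which may be empty) is not tangent to $SV^{\mathbf n}_{\mathbf d}$ along a positive dimensional subvariety: there is no irreducible closed subvariety $Y\subseteq SV^{\mathbf n}_{\mathbf d}$ with $\dim Y>0$ such that $T_ySV^{\mathbf n}_{\mathbf d}\subseteq H$ for all $y\in Y$. -/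

import Mathlib

open scoped LinearAlgebra.Projectivization Topology

noncomputable section

namespace SegreVeronese

/-! ### Zariski topologies on projective spaces and on products of projective spaces -/

/-- The Zariski topology on the complex projective space with homogeneous coordinates indexed by
`ι`: generated by the non-vanishing loci of homogeneous polynomials. -/
@[reducible] def zariski (ι : Type) : TopologicalSpace (ℙ ℂ (ι → ℂ)) :=
  TopologicalSpace.generateFrom
    {U | ∃ (m : ℕ) (F : MvPolynomial ι ℂ), F.IsHomogeneous m ∧
      U = {p | MvPolynomial.eval p.rep F ≠ 0}}

/-- The Zariski topology on the product of `κ` copies of a projective space: generated by the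
non-vanishing loci of multihomogeneous polynomials (homogeneous in each group of variables
`X (a, ·)`, of degree `m a`). This is not the product of the Zariski topologies. -/
@[reducible] def zariskiProd (κ ι : Type) [DecidableEq κ] : TopologicalSpace (κ → ℙ ℂ (ι → ℂ)) :=
  TopologicalSpace.generateFrom
    {U | ∃ (m : κ → ℕ) (F : MvPolynomial (κ × ι) ℂ),
      (∀ a, F.IsWeightedHomogeneous (fun b : κ × ι => if b.1 = a then (1 : ℕ) else 0) (m a)) ∧
      U = {p | MvPolynomial.eval (fun b : κ × ι => (p b.1).rep b.2) F ≠ 0}}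

/-- `P` holds for the general point of `Y`: it holds on a dense open subset of `Y`. -/
def HoldsGenerally {α : Type} (τ : TopologicalSpace α) (Y : Set α) (P : α → Prop) : Prop :=
  ∃ U : Set α, IsOpen[τ] U ∧ Y ⊆ closure[τ] (U ∩ Y) ∧ ∀ y ∈ U ∩ Y, P y

/-! ### Linear subspaces of projective space

A linear subspace of the projective space with coordinates indexed by `ι` is represented by the
corresponding vector subspace of `ι → ℂ`; spans of linear subspaces are sums of vector subspaces,
and inclusion is `≤`. -/

/-- The hyperplane `∑ J, a J * X J = 0`, for a point `a` of the dual projective space. -/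
def hyperplane {ι : Type} [Fintype ι] (a : ℙ ℂ (ι → ℂ)) : Submodule ℂ (ι → ℂ) where
  carrier := {x | ∑ J, a.rep J * x J = 0}
  add_mem' := by
    intro x y hx hy
    simp only [Set.mem_ofPred_eq, Pi.add_apply, mul_add, Finset.sum_add_distrib] at *
    rw [hx, hy, add_zero]
  zero_mem' := by simp
  smul_mem' := by
    intro c x hx
    simp only [Set.mem_ofPred_eq, Pi.smul_apply, smul_eq_mul] at *
    rw [Finset.sum_congr rfl (fun J _ => mul_left_comm (a.rep J) c (x J)), ← Finset.mul_sum, hx,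
      mul_zero]

/-! ### Osculating spaces and tangency -/

/-- The (mixed) partial derivative of `φ` at `0`, once along each of the coordinates
`i 0, …, i (k - 1)`. -/
def partialDeriv {ι : Type} [Fintype ι] {m : ℕ} (φ : (Fin m → ℂ) → (ι → ℂ)) {k : ℕ}
    (i : Fin k → Fin m) : ι → ℂ :=
  iteratedFDeriv ℂ k φ 0 (fun j => Pi.single (i j) (1 : ℂ))

/-- `φ`, defined near `0 ∈ ℂ^m` and given by homogeneous coordinates, is a local holomorphic
parametrization of `X` near `p = [φ 0]`: `t ↦ [φ t]` takes values in `X`, is an immersion at `0`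
(the vectors `φ 0, ∂φ/∂t_1 (0), …, ∂φ/∂t_m (0)` are independent), and maps neighbourhoods of `0`
onto neighbourhoods of `p` in `X` for the Euclidean topology. -/
structure IsLocalParametrization {ι : Type} [Fintype ι] (X : Set (ℙ ℂ (ι → ℂ)))
    (p : ℙ ℂ (ι → ℂ)) (m : ℕ) (φ : (Fin m → ℂ) → (ι → ℂ)) : Prop where
  analytic : AnalyticAt ℂ φ 0
  base : ∃ h : φ 0 ≠ 0, Projectivization.mk ℂ (φ 0) h = p
  mem : ∀ᶠ t in 𝓝 (0 : Fin m → ℂ), ∃ h : φ t ≠ 0, Projectivization.mk ℂ (φ t) h ∈ X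
  immersion : LinearIndependent ℂ
    (fun o : Option (Fin m) => o.elim (φ 0) (fun j => partialDeriv φ (fun _ : Fin 1 => j)))
  onto : ∀ W ∈ 𝓝 (0 : Fin m → ℂ), ∃ O ∈ 𝓝 (φ 0), ∀ x ∈ O, ∀ hx : x ≠ 0,
    Projectivization.mk ℂ x hx ∈ X →
      ∃ t ∈ W, ∃ h : φ t ≠ 0, Projectivization.mk ℂ (φ t) h = Projectivization.mk ℂ x hx

/-- The `s`-osculating space `T_p^s X` of `X` at a smooth point `p`: the linear space spanned by
the partial derivatives of order at most `s` at `0` of a local parametrization of `X` near `p`.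
In affine coordinates, i.e. for `φ = (1, f)`, it is the projective closure of the affine space
through `f 0` in the directions of the partial derivatives of `f` of order `1, …, s`.
All local parametrizations near `p` (they exist, `p` being smooth) give the same space, so the
supremum over them is this space. -/
def osculatingSpace {ι : Type} [Fintype ι] (X : Set (ℙ ℂ (ι → ℂ))) (s : ℕ)
    (p : ℙ ℂ (ι → ℂ)) : Submodule ℂ (ι → ℂ) :=
  ⨆ (m : ℕ) (φ : (Fin m → ℂ) → (ι → ℂ)) (_ : IsLocalParametrization X p m φ),
    Submodule.span ℂ {w | ∃ k ≤ s, ∃ i : Fin k → Fin m, w = partialDeriv φ i}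

/-- The linear space `H` is tangent to `X` along a positive dimensional subvariety: there is a
Zariski closed irreducible `Y ⊆ X` of positive dimension such that `H` contains the tangent space
`T_y X = T_y^1 X` for all `y ∈ Y`. -/
def IsTangentAlongPosDim {ι : Type} [Fintype ι] (X : Set (ℙ ℂ (ι → ℂ)))
    (H : Submodule ℂ (ι → ℂ)) : Prop :=
  ∃ Y : Set (ℙ ℂ (ι → ℂ)), Y ⊆ X ∧ IsClosed[zariski ι] Y ∧
    @IsIrreducible _ (zariski ι) Y ∧
    0 < @topologicalKrullDim Y ((zariski ι).induced Subtype.val) ∧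
    ∀ y ∈ Y, osculatingSpace X 1 y ≤ H

/-! ### Segre-Veronese varieties -/

variable {r : ℕ} (n d : Fin r → ℕ)

/-- Multi-indices `J = (J_1, …, J_r)`, where `J_k` is a multiset of `d_k` elements of
`{0, …, n_k}`. -/
abbrev MultiIndex : Type := (k : Fin r) → Sym (Fin (n k + 1)) (d k)

/-- All monomials of multidegree `(d_1, …, d_r)`, evaluated at `x = (x_1, …, x_r)` with
`x_k ∈ ℂ^(n_k + 1)`. -/
def monomials (x : (k : Fin r) → Fin (n k + 1) → ℂ) : MultiIndex n d → ℂ :=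
  fun J => ∏ k, ((J k : Multiset (Fin (n k + 1))).map (x k)).prod

theorem monomials_ne_zero {x : (k : Fin r) → Fin (n k + 1) → ℂ} (hx : ∀ k, x k ≠ 0) :
    monomials n d x ≠ 0 := by
  have h : ∀ k, ∃ j, x k j ≠ 0 := fun k => Function.ne_iff.mp (hx k)
  choose j hj using h
  refine Function.ne_iff.mpr ⟨fun k => Sym.replicate (d k) (j k), ?_⟩
  simp only [monomials, Pi.zero_apply]
  refine Finset.prod_ne_zero_iff.mpr fun k _ => ?_
  simp [Sym.coe_replicate, hj k]

/-- The Segre-Veronese variety: the image of `ℙ^(n_1) × ⋯ × ℙ^(n_r)` under the map given by all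
monomials of multidegree `(d_1, …, d_r)`, i.e. by the complete linear system
`|𝒪(d_1, …, d_r)|`. -/
def segreVeronese : Set (ℙ ℂ (MultiIndex n d → ℂ)) :=
  {p | ∃ (x : (k : Fin r) → Fin (n k + 1) → ℂ) (hx : ∀ k, x k ≠ 0),
    p = Projectivization.mk ℂ (monomials n d x) (monomials_ne_zero n d hx)}

end SegreVeronese

end

noncomputable section

namespace SegreVeronese

section

/-! ### A Bertini theorem for linear systems of polynomials -/

/-! Hyperplanes correspond to multihomogeneous forms, and a hyperplane contains the tangent space at
a point exactly when its form is singular there. Those containing `T` form a linear system `W`. The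
points are general in the sense that their coordinate vectors are independent in every factor
(`holdsGenerally_inGeneralPosition`).

If `r ≥ 2`, the base points of `W` are among the `p i`. For any other point `z`, independence gives
one linear form per factor, none vanishing at `z`, such that at each `p i` at least one of them
vanishes (`exists_separating_forms`). The product of their powers `l k ^ d k` has multiplicity at
least `δ` at every `p i`, hence lies in `W` (`pairing_formCoeff_eq_zero`, `exists_form_ne_zero`). By
Bertini (`exists_discriminant`, `exists_discriminant_on`) a general member of `W` is singular only
at base points, so the locus of tangency is finite.

If `r = 1`, there is no such hyperplane. A form of degree `δ` with multiplicity `δ` at a point is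
invariant under translation by the vector of that point (`pairing_monomials_add_smul`). The `n 0 +
1` vectors span, so the form is constant, hence zero (`formsVanishingOn_eq_bot`). -/

open MvPolynomial in
theorem derivation_aeval {σ K : Type} [Fintype σ] [Field K] [Algebra ℂ K]
    (D : Derivation ℂ K K) (x : σ → K) (f : MvPolynomial σ ℂ) :
    D (aeval x f) = ∑ s, aeval x (pderiv s f) * D (x s) := by
  classical
  induction f using MvPolynomial.induction_on with
  | C a => simp [← MvPolynomial.algebraMap_eq]
  | add p q hp hq => simp [hp, hq, add_mul, Finset.sum_add_distrib]
  | mul_X p t hp =>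
    simp only [map_mul, aeval_X, Derivation.leibniz, hp, pderiv_X, map_add, smul_eq_mul,
      add_mul, Finset.sum_add_distrib, Finset.mul_sum]
    congr 1
    · rw [Finset.sum_eq_single t]
      · simp
      · intro b _ hb
        simp [hb.symm]
      · simp
    · exact Finset.sum_congr rfl fun s _ => by ring

/-- For a formally étale extension, base change identifies the Kähler differentials of `A` with
those of `K`, so the linear map given by `d` transports to `K`. -/
theorem exists_derivation_extending {A K : Type} [CommRing A] [Field K] [Algebra ℂ A] [Algebra ℂ K]
    [Algebra A K] [IsScalarTower ℂ A K] [Algebra.FormallyEtale A K] (d : Derivation ℂ A A) :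
    ∃ D : Derivation ℂ K K, ∀ a, D (algebraMap A K a) = algebraMap A K (d a) := by
  let e : Derivation ℂ A K := (Algebra.linearMap A K).compDer d
  let L : TensorProduct A K (Ω[A⁄ℂ]) →ₗ[K] K := e.liftKaehlerDifferential.liftBaseChange K
  let M : Ω[K⁄ℂ] →ₗ[K] K :=
    L ∘ₗ (KaehlerDifferential.tensorKaehlerEquivOfFormallyEtale ℂ A K).symm.toLinearMap
  refine ⟨M.compDer (KaehlerDifferential.D ℂ K), fun a => ?_⟩
  have h := KaehlerDifferential.tensorKaehlerEquivOfFormallyEtale_symm_D_algebraMap ℂ A K a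
  simp [M, h, L, e]

-- The heart of Bertini. Extend `∂/∂X i₀` to a derivation `D` of `K` and apply it to `h0`: the terms
-- containing `D (x s)` cancel by `h1`, and what remains is `aeval x (f i₀)`.
open MvPolynomial in
theorem not_generic_singular {σ ι K : Type} [Fintype σ] [Fintype ι] [DecidableEq ι] [Field K]
    [Algebra ℂ K] [Algebra (MvPolynomial ι ℂ) K] [IsScalarTower ℂ (MvPolynomial ι ℂ) K]
    [Algebra.FormallyEtale (MvPolynomial ι ℂ) K] (f : ι → MvPolynomial σ ℂ) (i₀ : ι) (x : σ → K)
    (h0 : ∑ i, algebraMap (MvPolynomial ι ℂ) K (X i) * aeval x (f i) = 0)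
    (h1 : ∀ s, ∑ i, algebraMap (MvPolynomial ι ℂ) K (X i) * aeval x (pderiv s (f i)) = 0) :
    aeval x (f i₀) = 0 := by
  obtain ⟨D, hD⟩ := exists_derivation_extending (A := MvPolynomial ι ℂ) (K := K) (pderiv i₀)
  have h := congrArg D h0
  simp only [map_sum, Derivation.leibniz, hD, smul_eq_mul, map_zero, derivation_aeval,
    Finset.sum_add_distrib, pderiv_X] at h
  have h2 : ∑ i, algebraMap (MvPolynomial ι ℂ) K (X i) *
      ∑ s, aeval x (pderiv s (f i)) * D (x s) = 0 := by
    simp only [Finset.mul_sum]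
    rw [Finset.sum_comm]
    refine Finset.sum_eq_zero fun s _ => ?_
    simp only [← mul_assoc]
    rw [← Finset.sum_mul, h1, zero_mul]
  rw [h2, zero_add, Finset.sum_eq_single i₀] at h
  · simpa using h
  · intro b _ hb
    simp [hb.symm]
  · simp

-- Bertini by elimination: `P` is found in the ideal of pairs (member, singular point off `f i₀ =
-- 0`). If there were none, this incidence variety would have a point over a finite extension of the
-- function field of the parameter space, contrary to `not_generic_singular`.
open MvPolynomial in
theorem exists_discriminant {σ ι : Type} [Fintype σ] [Fintype ι] [DecidableEq ι]
    (f : ι → MvPolynomial σ ℂ) (i₀ : ι) :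
    ∃ P : MvPolynomial ι ℂ, P ≠ 0 ∧ ∀ (b : ι → ℂ) (x : σ → ℂ), eval x (f i₀) ≠ 0 →
      ∑ i, b i * eval x (f i) = 0 → (∀ s, ∑ i, b i * eval x (pderiv s (f i)) = 0) →
      eval b P = 0 := by
  set A := MvPolynomial ι ℂ
  let K₀ := FractionRing A
  let R := MvPolynomial (Option σ) A
  let g : MvPolynomial σ ℂ →ₐ[ℂ] R := aeval fun s => X (some s)
  let F : R := ∑ i, C (X i) * g (f i)
  let dF : σ → R := fun s => ∑ i, C (X i) * g (pderiv s (f i))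
  -- Rabinowitsch's trick: the extra variable `X none` is an inverse of `f i₀`.
  let I : Ideal R := Ideal.span (insert F (insert (X none * g (f i₀) - 1) (Set.range dF)))
  let _ : Algebra R (MvPolynomial (Option σ) K₀) := MvPolynomial.algebraMvPolynomial
  let Φ : R →+* MvPolynomial (Option σ) K₀ := MvPolynomial.map (algebraMap A K₀)
  by_cases hI : I.map Φ = ⊤
  -- Clearing denominators in an expression for `1` puts a nonzero constant `C P` into `I`.
  · have hd : ¬ Disjoint (((nonZeroDivisors A).map (C (σ := Option σ)) : Submonoid R) : Set R)
        (I : Set R) := by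
      rw [← IsLocalization.map_algebraMap_ne_top_iff_disjoint
        ((nonZeroDivisors A).map (C (σ := Option σ))) (MvPolynomial (Option σ) K₀)]
      exact not_not.mpr hI
    rw [Set.not_disjoint_iff] at hd
    obtain ⟨_, ⟨P, hP, rfl⟩, hPI⟩ := hd
    refine ⟨P, nonZeroDivisors.ne_zero hP, fun b x hx h0 h1 => ?_⟩
    let ψ : R →+* ℂ := eval₂Hom (eval b) (fun o => o.elim (eval x (f i₀))⁻¹ x)
    have hψC : ∀ a, ψ (C a) = eval b a := fun a => eval₂Hom_C _ _ _
    have hψX : ψ (X none) = (eval x (f i₀))⁻¹ := eval₂Hom_X' _ _ _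
    have hg : ∀ q, ψ (g q) = eval x q := by
      intro q
      have : (ψ.comp g.toRingHom) = eval x := by
        ext s <;> simp [ψ, g, R, A, MvPolynomial.algebraMap_eq]
      exact congrArg (fun h : MvPolynomial σ ℂ →+* ℂ => h q) this
    have hle : I ≤ RingHom.ker ψ := by
      refine Ideal.span_le.mpr ?_
      rintro y (rfl | rfl | ⟨s, rfl⟩)
      · simp only [SetLike.mem_coe, RingHom.mem_ker, F, map_sum, map_mul, hg, hψC, eval_X]
        exact h0
      · simp only [SetLike.mem_coe, RingHom.mem_ker, map_sub, map_mul, hg, map_one, hψX]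
        rw [inv_mul_cancel₀ hx, sub_self]
      · simp only [SetLike.mem_coe, RingHom.mem_ker, dF, map_sum, map_mul, hg, hψC, eval_X]
        exact h1 s
    rw [← hψC]
    exact hle hPI
  · exfalso
    obtain ⟨M, hM, hIM⟩ := Ideal.exists_le_maximal _ hI
    let K := MvPolynomial (Option σ) K₀ ⧸ M
    let _ : Field K := Ideal.Quotient.field M
    have : Algebra.FiniteType K₀ K := inferInstance
    -- Zariski's lemma; characteristic zero then makes `K` separable over `K₀`, hence formally étale
    -- over `A`.
    have : Module.Finite K₀ K := finite_of_finite_type_of_isJacobsonRing K₀ K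
    have : Algebra.IsAlgebraic K₀ K := Algebra.IsAlgebraic.of_finite K₀ K
    have : CharZero K₀ := charZero_of_injective_algebraMap (algebraMap ℂ K₀).injective
    have : Algebra.IsSeparable K₀ K := inferInstance
    have : Algebra.FormallyEtale K₀ K := Algebra.FormallyEtale.of_isSeparable K₀ K
    have : Algebra.FormallyEtale A K₀ :=
      Algebra.FormallyEtale.of_isLocalization (nonZeroDivisors A)
    have : Algebra.FormallyEtale A K := Algebra.FormallyEtale.comp A K₀ K
    let π : R →+* K := (Ideal.Quotient.mk M).comp Φ
    have hπ : ∀ y ∈ I, π y = 0 := fun y hy =>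
      Ideal.Quotient.eq_zero_iff_mem.mpr (hIM (Ideal.mem_map_of_mem _ hy))
    let x : σ → K := fun s => π (X (some s))
    have hC : ∀ a : A, π (C a) = algebraMap A K a := by
      intro a
      rw [RingHom.comp_apply, MvPolynomial.map_C]
      rfl
    have hg : ∀ q, π (g q) = aeval x q := by
      intro q
      have : (π.comp g.toRingHom) = (aeval x : MvPolynomial σ ℂ →ₐ[ℂ] K).toRingHom := by
        refine MvPolynomial.ringHom_ext (fun c => ?_) fun s => ?_
        · have h2 : (algebraMap ℂ R c) = C (C c) := rfl
          simp only [RingHom.comp_apply, AlgHom.toRingHom_eq_coe, RingHom.coe_coe, algHom_C, h2, hC]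
          rfl
        · simp [x, g]
      exact congrArg (fun h : MvPolynomial σ ℂ →+* K => h q) this
    have hz := not_generic_singular f i₀ x
      (by
        have := hπ F (Ideal.subset_span (by simp))
        simpa only [F, map_sum, map_mul, hC, hg] using this)
      (fun s => by
        have := hπ (dF s) (Ideal.subset_span (by simp))
        simpa only [dF, map_sum, map_mul, hC, hg] using this)
    have := hπ (X none * g (f i₀) - 1) (Ideal.subset_span (by simp))
    rw [map_sub, map_mul, hg, hz, mul_zero, map_one, zero_sub, neg_eq_zero] at this
    exact one_ne_zero this

end

/-! ### Homogeneous discriminants -/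

section

open MvPolynomial in
theorem IsHomogeneous.eval_smul {ι : Type} {P : MvPolynomial ι ℂ} {m : ℕ}
    (hP : P.IsHomogeneous m) (c : ℂ) (b : ι → ℂ) : eval (c • b) P = c ^ m * eval b P := by
  rw [eval_eq, eval_eq, Finset.mul_sum]
  refine Finset.sum_congr rfl fun e he => ?_
  have : e.sum (fun _ k => k) = m := by
    simpa [Finsupp.weight_apply] using hP (mem_support_iff.mp he)
  simp only [Pi.smul_apply, smul_eq_mul, mul_pow, Finset.prod_mul_distrib, Finset.prod_pow_eq_pow_sum]
  rw [← this, Finsupp.sum]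
  ring

-- The values of the homogeneous components at `b` are the coefficients of the polynomial `c ↦ P (c
-- • b)`, which vanishes identically.
open MvPolynomial in
theorem eval_homogeneousComponent_eq_zero {ι : Type} (P : MvPolynomial ι ℂ) (b : ι → ℂ)
    (h : ∀ c : ℂ, eval (c • b) P = 0) (m : ℕ) : eval b (homogeneousComponent m P) = 0 := by
  let q : Polynomial ℂ := ∑ i ∈ Finset.range (P.totalDegree + 1),
    Polynomial.monomial i (eval b (homogeneousComponent i P))
  have hq : q = 0 := by
    refine Polynomial.funext fun c => ?_
    rw [Polynomial.eval_finsetSum, Polynomial.eval_zero, ← h c]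
    conv_rhs => rw [← sum_homogeneousComponent P, map_sum]
    refine Finset.sum_congr rfl fun i _ => ?_
    rw [IsHomogeneous.eval_smul (homogeneousComponent_isHomogeneous i P), Polynomial.eval_monomial,
      mul_comm]
  by_cases hm : m < P.totalDegree + 1
  · have := congrArg (Polynomial.coeff · m) hq
    simpa [q, Polynomial.finsetSum_coeff, Polynomial.coeff_monomial, hm] using this
  · rw [homogeneousComponent_eq_zero _ _ (by omega), map_zero]

-- The product of the discriminants over all charts `c` and all `i` serves every chart at once.
-- Being singular at `x` is unaffected by scaling `b`, so the product vanishes on whole lines and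
-- any nonzero homogeneous component of it may replace it.
open MvPolynomial in
theorem exists_homogeneous_discriminant {ι : Type} [Fintype ι] {κ : Type} [Fintype κ]
    {σ : κ → Type} [∀ c, Fintype (σ c)] (f : ∀ c, ι → MvPolynomial (σ c) ℂ) :
    ∃ (m : ℕ) (P : MvPolynomial ι ℂ), P.IsHomogeneous m ∧ P ≠ 0 ∧
      ∀ (c : κ) (b : ι → ℂ) (x : σ c → ℂ), (∃ i, eval x (f c i) ≠ 0) →
      ∑ i, b i * eval x (f c i) = 0 → (∀ s, ∑ i, b i * eval x (pderiv s (f c i)) = 0) →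
      eval b P = 0 := by
  classical
  choose P hP0 hP using fun c i => exists_discriminant (f c) i
  let Q : MvPolynomial ι ℂ := ∏ c, ∏ i, P c i
  have hQ0 : Q ≠ 0 := Finset.prod_ne_zero_iff.mpr fun c _ => Finset.prod_ne_zero_iff.mpr
    fun i _ => hP0 c i
  obtain ⟨m, hm⟩ : ∃ m, homogeneousComponent m Q ≠ 0 := by
    by_contra! h
    apply hQ0
    rw [← sum_homogeneousComponent Q]
    exact Finset.sum_eq_zero fun i _ => h i
  refine ⟨m, _, homogeneousComponent_isHomogeneous m Q, hm, fun c b x ⟨i, hi⟩ h0 h1 => ?_⟩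
  refine eval_homogeneousComponent_eq_zero Q b (fun t => ?_) m
  have : eval (t • b) (P c i) = 0 := by
    refine hP c i _ x hi ?_ fun s => ?_
    · simp only [Pi.smul_apply, smul_eq_mul, mul_assoc, ← Finset.mul_sum, h0, mul_zero]
    · simp only [Pi.smul_apply, smul_eq_mul, mul_assoc, ← Finset.mul_sum, h1, mul_zero]
  simp only [Q, map_prod]
  exact Finset.prod_eq_zero (Finset.mem_univ c) (Finset.prod_eq_zero (Finset.mem_univ i) this)

/-! ### Functions vanishing to a given order -/

/-- Differentiating `h ^ (s + 1) • u` leaves a factor `h ^ s`. The target `G` varies in the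
induction because the derivative takes values in a space of linear maps. -/
theorem iteratedFDeriv_pow_smul_eq_zero {E : Type} [NormedAddCommGroup E] [NormedSpace ℂ E]
    {x : E} {h : E → ℂ} (hh : AnalyticAt ℂ h x) (h0 : h x = 0) (s : ℕ) :
    ∀ {G : Type} [NormedAddCommGroup G] [NormedSpace ℂ G] [CompleteSpace G] {u g : E → G},
      AnalyticAt ℂ u x → (g =ᶠ[𝓝 x] fun t => h t ^ s • u t) →
      ∀ k < s, iteratedFDeriv ℂ k g x = 0 := by
  induction s with
  | zero => intro G _ _ _ u g _ _ k hk; omega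
  | succ s ih =>
    intro G _ _ _ u g hu hg k hk
    cases k with
    | zero =>
      ext v
      simp [iteratedFDeriv_zero_apply, hg.eq_of_nhds, h0]
    | succ k =>
      have hk' : k < s := by omega
      have hd : fderiv ℂ g =ᶠ[𝓝 x] fun t => h t ^ s •
          (((s + 1 : ℕ) : ℂ) • (fderiv ℂ h t).smulRight (u t) + h t • fderiv ℂ u t) := by
        have h1 := hg.fderiv (𝕜 := ℂ)
        filter_upwards [h1, hh.eventually_analyticAt, hu.eventually_analyticAt] with t ht hht hut
        rw [ht]
        have e1 := (hht.differentiableAt.hasFDerivAt.pow (s + 1)).smul hut.differentiableAt.hasFDerivAt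
        refine e1.fderiv.trans ?_
        ext v
        simp only [add_apply, smul_apply, ContinuousLinearMap.smulRight_apply, smul_eq_mul,
          Nat.add_sub_cancel, nsmul_eq_mul]
        module
      have := ih (u := fun t => (((s + 1 : ℕ) : ℂ) • (fderiv ℂ h t).smulRight (u t) +
        h t • fderiv ℂ u t)) (g := fderiv ℂ g) (by
          have e1 := hh.fderiv
          have e2 := hu.fderiv
          have e3 : AnalyticAt ℂ (fun t => (fderiv ℂ h t).smulRight (u t)) x :=
            ((ContinuousLinearMap.smulRightL ℂ E G).analyticAt_bilinear _).comp₂ e1 hu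
          have e4 : AnalyticAt ℂ (fun _ : E => (((s + 1 : ℕ) : ℂ))) x := analyticAt_const
          exact (e4.smul e3).add (hh.smul e2)) hd k hk'
      ext v
      rw [iteratedFDeriv_succ_apply_right, this]
      simp

end

section

variable {r : ℕ} (n d : Fin r → ℕ)

/-! ### Monomials and products of linear forms -/

/-- The multi-index with the given entries. -/
def tupleIndex (s : (k : Fin r) → Fin (d k) → Fin (n k + 1)) : MultiIndex n d :=
  fun k => ⟨Multiset.map (s k) Finset.univ.val, by simp⟩

theorem monomials_tupleIndex (s : (k : Fin r) → Fin (d k) → Fin (n k + 1))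
    (x : (k : Fin r) → Fin (n k + 1) → ℂ) :
    monomials n d x (tupleIndex n d s) = ∏ k, ∏ i, x k (s k i) := by
  simp only [monomials, tupleIndex]
  refine Finset.prod_congr rfl fun k _ => ?_
  change ((Multiset.map (s k) Finset.univ.val).map (x k)).prod = _
  rw [Multiset.map_map]
  rfl

theorem monomials_smul (c : Fin r → ℂ) (x : (k : Fin r) → Fin (n k + 1) → ℂ) :
    monomials n d (fun k => c k • x k) = (∏ k, c k ^ d k) • monomials n d x := by
  ext J
  simp only [monomials, Pi.smul_apply, smul_eq_mul, ← Finset.prod_mul_distrib]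
  refine Finset.prod_congr rfl fun k _ => ?_
  have : (fun j => c k * x k j) = fun j => (fun _ => c k) j * x k j := rfl
  change (Multiset.map (fun j => c k * x k j) _).prod = _
  rw [Multiset.prod_map_mul, Multiset.map_const', Multiset.prod_replicate]
  congr 2
  exact (J k).2

/-- The coefficients of a product of linear forms, `d k` of them in the `k`-th group of variables. -/
def formCoeff (l : (k : Fin r) → Fin (d k) → Fin (n k + 1) → ℂ) : MultiIndex n d → ℂ := by
  classical
  exact fun J => ∑ s with tupleIndex n d s = J, ∏ k, ∏ i, l k i (s k i)

/-- Expanding the product gives a sum over tuples of indices; `formCoeff` collects the tuples with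
the same underlying multisets. -/
theorem sum_formCoeff_mul_monomials (l : (k : Fin r) → Fin (d k) → Fin (n k + 1) → ℂ)
    (x : (k : Fin r) → Fin (n k + 1) → ℂ) :
    ∑ J, formCoeff n d l J * monomials n d x J = ∏ k, ∏ i, ∑ j, l k i j * x k j := by
  classical
  have h1 : ∀ J, formCoeff n d l J * monomials n d x J =
      ∑ s with tupleIndex n d s = J, ∏ k, ∏ i, l k i (s k i) * x k (s k i) := by
    intro J
    rw [formCoeff, Finset.sum_mul]
    refine Finset.sum_congr rfl fun s hs => ?_
    rw [← (Finset.mem_filter.mp hs).2, monomials_tupleIndex]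
    simp only [Finset.prod_mul_distrib]
  simp only [h1]
  rw [Finset.sum_fiberwise]
  simp only [Finset.prod_univ_sum, Fintype.piFinset_univ]

/-! ### Affine charts -/

variable {n}

/-- The coordinates of the affine chart of `ℙ^(n_1) × ⋯ × ℙ^(n_r)` where the coordinates `c k` are
equal to `1`. -/
abbrev ChartIndex (c : (k : Fin r) → Fin (n k + 1)) : Type :=
  (k : Fin r) × {j : Fin (n k + 1) // j ≠ c k}

/-- The point of an affine chart with the given coordinates. -/
def chart {R : Type} [One R] (c : (k : Fin r) → Fin (n k + 1)) (t : ChartIndex c → R) (k : Fin r)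
    (j : Fin (n k + 1)) : R :=
  if h : j = c k then 1 else t ⟨k, j, h⟩

variable (c : (k : Fin r) → Fin (n k + 1))

@[simp] theorem chart_pivot {R : Type} [One R] (t : ChartIndex c → R) (k : Fin r) :
    chart c t k (c k) = 1 := by simp [chart]

theorem chart_apply {R : Type} [One R] (t : ChartIndex c → R) (i : ChartIndex c) :
    chart c t i.1 i.2 = t i := by simp [chart, i.2.2]

theorem chart_ne_zero (t : ChartIndex c → ℂ) (k : Fin r) : chart c t k ≠ 0 := fun h => by
  simpa using congrFun h (c k)

/-- The monomial with index `J` in an affine chart. -/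
def chartMonomial (J : MultiIndex n d) : MvPolynomial (ChartIndex c) ℂ :=
  ∏ k, ((J k : Multiset (Fin (n k + 1))).map (chart c MvPolynomial.X k)).prod

theorem eval_chartMonomial (J : MultiIndex n d) (t : ChartIndex c → ℂ) :
    MvPolynomial.eval t (chartMonomial d c J) = monomials n d (chart c t) J := by
  simp only [chartMonomial, monomials, map_prod, map_multiset_prod, Multiset.map_map]
  refine Finset.prod_congr rfl fun k _ => ?_
  congr 2
  ext j
  simp only [chart, Function.comp_apply]
  split_ifs <;> simp

/-- The restriction to an affine chart of the form with coefficients `a`. -/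
def chartForm (a : MultiIndex n d → ℂ) : MvPolynomial (ChartIndex c) ℂ :=
  ∑ J, MvPolynomial.C (a J) * chartMonomial d c J

theorem eval_chartForm (a : MultiIndex n d → ℂ) (t : ChartIndex c → ℂ) :
    MvPolynomial.eval t (chartForm d c a) = ∑ J, a J * monomials n d (chart c t) J := by
  simp [chartForm, eval_chartMonomial]

/-- The parametrization of the Segre-Veronese variety given by an affine chart centered at `t₀`. -/
def chartMap (t₀ : ChartIndex c → ℂ) (t : Fin (Fintype.card (ChartIndex c)) → ℂ) :
    MultiIndex n d → ℂ :=
  monomials n d (chart c (fun i => t₀ i + t (Fintype.equivFin _ i)))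

theorem chartMap_ne_zero (t₀ : ChartIndex c → ℂ) (t : Fin (Fintype.card (ChartIndex c)) → ℂ) :
    chartMap d c t₀ t ≠ 0 :=
  monomials_ne_zero n d fun k => chart_ne_zero c _ k

/-- The index of the monomial that is `1` on the chart. -/
def pivotIndex : MultiIndex n d := tupleIndex n d fun k _ => c k

theorem monomials_pivotIndex (t : ChartIndex c → ℂ) :
    monomials n d (chart c t) (pivotIndex d c) = 1 := by
  simp [pivotIndex, monomials_tupleIndex]

/-- The index of the monomial that is the coordinate `i` on the chart. -/
def coordIndex [∀ k, NeZero (d k)] (i : ChartIndex c) : MultiIndex n d :=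
  tupleIndex n d (Function.update (fun k _ => c k) i.1 (Function.update (fun _ => c i.1) 0 i.2))

theorem monomials_coordIndex [∀ k, NeZero (d k)] (t : ChartIndex c → ℂ) (i : ChartIndex c) :
    monomials n d (chart c t) (coordIndex d c i) = t i := by
  rw [coordIndex, monomials_tupleIndex, Finset.prod_eq_single i.1]
  · rw [Function.update_self, Finset.prod_eq_single 0]
    · rw [Function.update_self, chart_apply]
    · intro b _ hb
      rw [Function.update_of_ne hb, chart_pivot]
    · simp
  · intro k _ hk
    rw [Function.update_of_ne hk]
    simp
  · simp

theorem analyticAt_chartMap (t₀ : ChartIndex c → ℂ) (t : Fin (Fintype.card (ChartIndex c)) → ℂ) :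
    AnalyticAt ℂ (chartMap d c t₀) t := by
  refine AnalyticAt.pi fun J => ?_
  have : (fun t => chartMap d c t₀ t J) = fun t => MvPolynomial.aeval
      (fun i => t₀ i + t (Fintype.equivFin _ i)) (chartMonomial d c J) := by
    ext t
    rw [MvPolynomial.aeval_eq_eval]
    exact (eval_chartMonomial d c J _).symm
  rw [this]
  refine AnalyticAt.aeval_mvPolynomial (fun i => ?_) _
  refine analyticAt_const.add ?_
  exact (ContinuousLinearMap.proj (R := ℂ) (φ := fun _ => ℂ) (Fintype.equivFin _ i)).analyticAt t

theorem hasFDerivAt_eval {σ : Type} [Fintype σ] (p : MvPolynomial σ ℂ) (x : σ → ℂ) :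
    HasFDerivAt (fun x => MvPolynomial.eval x p)
      (∑ s, MvPolynomial.eval x (MvPolynomial.pderiv s p) •
        (ContinuousLinearMap.proj s : (σ → ℂ) →L[ℂ] ℂ)) x := by
  classical
  induction p using MvPolynomial.induction_on with
  | C a =>
    simp only [MvPolynomial.eval_C]
    exact (hasFDerivAt_const a x).congr_fderiv (by ext v; simp)
  | add p q hp hq =>
    simp only [map_add]
    refine (hp.add hq).congr_fderiv ?_
    ext v
    simp [add_mul, Finset.sum_add_distrib]
  | mul_X p t hp =>
    simp only [map_mul, MvPolynomial.eval_X]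
    have h2 : HasFDerivAt (fun x : σ → ℂ => x t)
        (ContinuousLinearMap.proj t : (σ → ℂ) →L[ℂ] ℂ) x :=
      (ContinuousLinearMap.proj (R := ℂ) (φ := fun _ : σ => ℂ) t).hasFDerivAt
    refine (hp.mul h2).congr_fderiv ?_
    ext v
    simp only [Derivation.leibniz, smul_eq_mul, MvPolynomial.pderiv_X, map_add, map_mul,
      MvPolynomial.eval_X, sum_apply, smul_apply, ContinuousLinearMap.proj_apply, add_apply,
      add_mul, Finset.sum_add_distrib, Finset.mul_sum]
    congr 1
    · rw [Finset.sum_eq_single t]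
      · simp
      · intro b _ hb
        simp [hb.symm]
      · simp
    · exact Finset.sum_congr rfl fun s _ => by ring

/-- Composing `chartMap` with the linear form `a` gives the polynomial `chartForm d c a` recentred
at `t₀`; the two computations of its derivative must agree. This links analytic tangency to
algebraic singularity. -/
theorem sum_mul_partialDeriv_chartMap (t₀ : ChartIndex c → ℂ) (a : MultiIndex n d → ℂ)
    (i : ChartIndex c) :
    ∑ J, a J * partialDeriv (chartMap d c t₀) (fun _ : Fin 1 => Fintype.equivFin _ i) J =
      MvPolynomial.eval t₀ (MvPolynomial.pderiv i (chartForm d c a)) := by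
  classical
  let A : (MultiIndex n d → ℂ) →L[ℂ] ℂ := ∑ J, a J • ContinuousLinearMap.proj J
  have hA : ∀ v, A v = ∑ J, a J * v J := fun v => by simp [A]
  have hφ : HasFDerivAt (chartMap d c t₀) (fderiv ℂ (chartMap d c t₀) 0) 0 :=
    (analyticAt_chartMap d c t₀ 0).differentiableAt.hasFDerivAt
  have h1 := A.hasFDerivAt.comp 0 hφ
  let e : (Fin (Fintype.card (ChartIndex c)) → ℂ) →L[ℂ] (ChartIndex c → ℂ) :=
    ContinuousLinearMap.pi fun i => ContinuousLinearMap.proj (Fintype.equivFin _ i)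
  have h2 : HasFDerivAt (fun t : Fin (Fintype.card (ChartIndex c)) → ℂ => t₀ + e t) e 0 :=
    e.hasFDerivAt.const_add t₀
  have h3 := (hasFDerivAt_eval (chartForm d c a) (t₀ + e 0)).comp 0 h2
  have h4 : (A ∘ chartMap d c t₀) =
      (fun x => MvPolynomial.eval x (chartForm d c a)) ∘ fun t => t₀ + e t := by
    ext t
    simp only [Function.comp_apply, hA, eval_chartForm]
    rfl
  rw [h4] at h1
  have h5 := congrArg (fun T => T (Pi.single (Fintype.equivFin _ i) (1 : ℂ))) (h1.unique h3)
  rw [← hA, partialDeriv, iteratedFDeriv_one_apply]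
  refine h5.trans ?_
  simp only [ContinuousLinearMap.comp_apply, sum_apply, smul_apply,
    ContinuousLinearMap.proj_apply, map_zero, add_zero, smul_eq_mul]
  rw [Finset.sum_eq_single i]
  · simp [e]
  · intro b _ hb
    simp [e, hb]
  · simp

end

/-! ### Affine charts as local parametrizations -/

section

variable {r : ℕ} {n : Fin r → ℕ} (d : Fin r → ℕ) (c : (k : Fin r) → Fin (n k + 1))

theorem monomials_eq_smul_chart (x : (k : Fin r) → Fin (n k + 1) → ℂ) (hx : ∀ k, x k (c k) ≠ 0) :
    monomials n d x = (∏ k, x k (c k) ^ d k) •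
      monomials n d (chart c fun i => x i.1 i.2 / x i.1 (c i.1)) := by
  rw [← monomials_smul]
  congr 1
  ext k j
  simp only [Pi.smul_apply, smul_eq_mul, chart]
  split_ifs with h
  · rw [h, mul_one]
  · rw [mul_div_cancel₀ _ (hx k)]

theorem exists_chart_eq {p : ℙ ℂ (MultiIndex n d → ℂ)} (hp : p ∈ segreVeronese n d) :
    ∃ (c : (k : Fin r) → Fin (n k + 1)) (t : ChartIndex c → ℂ),
      p = Projectivization.mk ℂ (monomials n d (chart c t))
        (monomials_ne_zero n d (chart_ne_zero c t)) := by
  obtain ⟨x, hx, rfl⟩ := hp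
  have h : ∀ k, ∃ j, x k j ≠ 0 := fun k => Function.ne_iff.mp (hx k)
  choose c hc using h
  refine ⟨c, fun i => x i.1 i.2 / x i.1 (c i.1), ?_⟩
  rw [Projectivization.mk_eq_mk_iff']
  exact ⟨_, (monomials_eq_smul_chart d c x hc).symm⟩

theorem chartForm_single (J : MultiIndex n d) :
    chartForm d c (Pi.single J 1) = chartMonomial d c J := by
  classical
  rw [chartForm, Finset.sum_eq_single J]
  · simp
  · intro b _ hb
    simp [hb]
  · simp

theorem chartMonomial_pivotIndex : chartMonomial d c (pivotIndex d c) = 1 :=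
  MvPolynomial.funext fun t => by simp [eval_chartMonomial, monomials_pivotIndex]

theorem partialDeriv_chartMap (t₀ : ChartIndex c → ℂ) (i : ChartIndex c) (J : MultiIndex n d) :
    partialDeriv (chartMap d c t₀) (fun _ : Fin 1 => Fintype.equivFin _ i) J =
      MvPolynomial.eval t₀ (MvPolynomial.pderiv i (chartMonomial d c J)) := by
  classical
  rw [← chartForm_single, ← sum_mul_partialDeriv_chartMap, Finset.sum_eq_single J]
  · simp
  · intro b _ hb
    simp [hb]
  · simp

variable [∀ k, NeZero (d k)]

theorem chartMonomial_coordIndex (i : ChartIndex c) :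
    chartMonomial d c (coordIndex d c i) = MvPolynomial.X i :=
  MvPolynomial.funext fun t => by simp [eval_chartMonomial, monomials_coordIndex]

theorem exists_eq_smul_chart {x : MultiIndex n d → ℂ} (hx : x ≠ 0)
    (hX : Projectivization.mk ℂ x hx ∈ segreVeronese n d) (h1 : x (pivotIndex d c) ≠ 0) :
    ∃ (ν : ℂ) (τ : ChartIndex c → ℂ), ν ≠ 0 ∧ x = ν • monomials n d (chart c τ) := by
  obtain ⟨z, hz, hxz⟩ := hX
  rw [Projectivization.mk_eq_mk_iff'] at hxz
  obtain ⟨μ, rfl⟩ := hxz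
  have hzc : ∀ k, z k (c k) ≠ 0 := by
    intro k hk
    apply h1
    rw [Pi.smul_apply, pivotIndex, monomials_tupleIndex, Finset.prod_eq_zero (Finset.mem_univ k),
      smul_zero]
    exact Finset.prod_eq_zero (Finset.mem_univ 0) hk
  rw [monomials_eq_smul_chart d c z hzc, smul_smul] at *
  exact ⟨_, _, fun h => hx (by rw [h, zero_smul]), rfl⟩

theorem isLocalParametrization_chartMap (t₀ : ChartIndex c → ℂ) :
    IsLocalParametrization (segreVeronese n d)
      (Projectivization.mk ℂ (monomials n d (chart c t₀))
        (monomials_ne_zero n d (chart_ne_zero c t₀))) _ (chartMap d c t₀) where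
  analytic := analyticAt_chartMap d c t₀ 0
  base := by
    refine ⟨chartMap_ne_zero d c t₀ 0, ?_⟩
    congr 1
    simp [chartMap]
  mem := Filter.Eventually.of_forall fun t => ⟨chartMap_ne_zero d c t₀ t, _,
    chart_ne_zero c _, rfl⟩
  immersion := by
    classical
    rw [Fintype.linearIndependent_iff]
    intro g hg
    have hco : ∀ J, g none * monomials n d (chart c t₀) J +
        ∑ i, g (some (Fintype.equivFin _ i)) *
          MvPolynomial.eval t₀ (MvPolynomial.pderiv i (chartMonomial d c J)) = 0 := by
      intro J
      have h := congrFun hg J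
      rw [Fintype.sum_option] at h
      simp only [Option.elim, Pi.add_apply, Pi.smul_apply, smul_eq_mul, Finset.sum_apply,
        Pi.zero_apply] at h
      rw [← (Fintype.equivFin (ChartIndex c)).sum_comp] at h
      simp only [partialDeriv_chartMap] at h
      simpa [chartMap] using h
    -- The pivot monomial is constantly `1` on the chart, so it isolates the coefficient of the
    -- point itself; the coordinate monomials then isolate the others.
    have h0 : g none = 0 := by
      have := hco (pivotIndex d c)
      rw [chartMonomial_pivotIndex, monomials_pivotIndex] at this
      simpa using this
    rintro (_ | j)
    · exact h0
    · obtain ⟨i, rfl⟩ := (Fintype.equivFin (ChartIndex c)).surjective j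
      have := hco (coordIndex d c i)
      rw [h0, zero_mul, zero_add, chartMonomial_coordIndex, Finset.sum_eq_single i] at this
      · simpa using this
      · intro b _ hb
        simp [MvPolynomial.pderiv_X, hb.symm]
      · simp
  onto := by
    intro W hW
    -- A left inverse of the parametrization, defined and continuous where the pivot coordinate is
    -- nonzero, up to scaling of `x`.
    let ρ : (MultiIndex n d → ℂ) → (Fin (Fintype.card (ChartIndex c)) → ℂ) := fun x j =>
      x (coordIndex d c ((Fintype.equivFin _).symm j)) / x (pivotIndex d c) -
        t₀ ((Fintype.equivFin _).symm j)
    have hφ0 : chartMap d c t₀ 0 = monomials n d (chart c t₀) := by simp [chartMap]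
    have h1 : chartMap d c t₀ 0 (pivotIndex d c) = 1 := by
      rw [hφ0, monomials_pivotIndex]
    have hρ0 : ρ (chartMap d c t₀ 0) = 0 := by
      ext j
      simp only [ρ, h1]
      rw [hφ0, monomials_coordIndex]
      simp
    have hρ : ContinuousAt ρ (chartMap d c t₀ 0) := by
      refine continuousAt_pi.mpr fun j => ?_
      refine ContinuousAt.sub (ContinuousAt.div ?_ ?_ ?_) continuousAt_const
      · exact (continuous_apply _).continuousAt
      · exact (continuous_apply _).continuousAt
      · rw [h1]; exact one_ne_zero
    have hne : ∀ᶠ x in 𝓝 (chartMap d c t₀ 0), x (pivotIndex d c) ≠ 0 :=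
      (continuous_apply (pivotIndex d c)).continuousAt.eventually_ne (by rw [h1]; exact one_ne_zero)
    refine ⟨_, Filter.inter_mem hne (hρ (hρ0.symm ▸ hW)), fun x hxO hx hxX => ?_⟩
    obtain ⟨hx1, hx2⟩ := hxO
    obtain ⟨ν, τ, hν, rfl⟩ := exists_eq_smul_chart d c hx hxX hx1
    refine ⟨_, hx2, chartMap_ne_zero d c t₀ _, ?_⟩
    rw [Projectivization.mk_eq_mk_iff']
    refine ⟨ν⁻¹, ?_⟩
    rw [smul_smul, inv_mul_cancel₀ hν, one_smul, chartMap]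
    congr 2
    ext i
    simp only [ρ, Equiv.symm_apply_apply, Pi.smul_apply, smul_eq_mul, monomials_coordIndex,
      monomials_pivotIndex]
    field_simp
    ring

theorem partialDeriv_chartMap_mem_osculatingSpace (t₀ : ChartIndex c → ℂ) {s k : ℕ} (hk : k ≤ s)
    (i : Fin k → Fin (Fintype.card (ChartIndex c))) :
    partialDeriv (chartMap d c t₀) i ∈ osculatingSpace (segreVeronese n d) s
      (Projectivization.mk ℂ (monomials n d (chart c t₀))
        (monomials_ne_zero n d (chart_ne_zero c t₀))) := by
  refine Submodule.mem_iSup_of_mem _ (Submodule.mem_iSup_of_mem (chartMap d c t₀)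
    (Submodule.mem_iSup_of_mem (isLocalParametrization_chartMap d c t₀) ?_))
  exact Submodule.subset_span ⟨k, hk, i, rfl⟩

theorem chartForm_singular_of_osculatingSpace_le (t₀ : ChartIndex c → ℂ)
    (a : ℙ ℂ (MultiIndex n d → ℂ))
    (h : osculatingSpace (segreVeronese n d) 1
      (Projectivization.mk ℂ (monomials n d (chart c t₀))
        (monomials_ne_zero n d (chart_ne_zero c t₀))) ≤ hyperplane a) :
    MvPolynomial.eval t₀ (chartForm d c a.rep) = 0 ∧
      ∀ i, MvPolynomial.eval t₀ (MvPolynomial.pderiv i (chartForm d c a.rep)) = 0 := by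
  refine ⟨?_, fun i => ?_⟩
  · have := h (partialDeriv_chartMap_mem_osculatingSpace d c t₀ zero_le_one Fin.elim0)
    rw [eval_chartForm]
    simpa [partialDeriv, hyperplane, chartMap] using this
  · rw [← sum_mul_partialDeriv_chartMap]
    exact h (partialDeriv_chartMap_mem_osculatingSpace d c t₀ le_rfl _)

end

/-! ### Products of linear forms and osculating spaces -/

section

variable {r : ℕ} {n : Fin r → ℕ} (d : Fin r → ℕ) (c : (k : Fin r) → Fin (n k + 1))

theorem monomials_tupleIndex_update [∀ k, NeZero (d k)] (t : ChartIndex c → ℂ) (k : Fin r)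
    (j : Fin (n k + 1)) :
    monomials n d (chart c t) (tupleIndex n d
      (Function.update (fun k _ => c k) k (Function.update (fun _ => c k) 0 j))) =
      chart c t k j := by
  rw [monomials_tupleIndex, Finset.prod_eq_single k]
  · rw [Function.update_self, Finset.prod_eq_single 0]
    · rw [Function.update_self]
    · intro b _ hb
      rw [Function.update_of_ne hb, chart_pivot]
    · simp
  · intro k' _ hk
    rw [Function.update_of_ne hk]
    simp
  · simp

/-- The linear form on the ambient space with coefficients `a`. -/
def pairing {ι : Type} [Fintype ι] (a : ι → ℂ) : (ι → ℂ) →L[ℂ] ℂ :=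
  ∑ J, a J • ContinuousLinearMap.proj J

theorem pairing_apply {ι : Type} [Fintype ι] (a v : ι → ℂ) : pairing a v = ∑ J, a J * v J := by
  simp [pairing]

theorem pairing_partialDeriv {ι : Type} [Fintype ι] (a : ι → ℂ) {m : ℕ}
    {φ : (Fin m → ℂ) → (ι → ℂ)} (hφ : AnalyticAt ℂ φ 0) {k : ℕ} (i : Fin k → Fin m) :
    pairing a (partialDeriv φ i) =
      iteratedFDeriv ℂ k (pairing a ∘ φ) 0 (fun j => Pi.single (i j) (1 : ℂ)) := by
  rw [(pairing a).iteratedFDeriv_comp_left (n := k) hφ.contDiffAt le_rfl]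
  rfl

/-- Along a parametrization, the form `∏ l k ^ d k` contains the `d k₀`-th power of a function
vanishing at `0`, so its derivatives of order at most `s < d k₀` vanish. Since `osculatingSpace` is
a supremum, an arbitrary parametrization `φ` has to be treated. -/
theorem pairing_formCoeff_eq_zero [∀ k, NeZero (d k)] (t₀ : ChartIndex c → ℂ)
    (l : (k : Fin r) → Fin (n k + 1) → ℂ) (k₀ : Fin r)
    (hk₀ : ∑ j, l k₀ j * chart c t₀ k₀ j = 0) (s : ℕ) (hs : s < d k₀) :
    osculatingSpace (segreVeronese n d) s (Projectivization.mk ℂ (monomials n d (chart c t₀))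
        (monomials_ne_zero n d (chart_ne_zero c t₀))) ≤
      LinearMap.ker (pairing (formCoeff n d fun k _ => l k)).toLinearMap := by
  refine iSup_le fun m => iSup_le fun φ => iSup_le fun hφ => Submodule.span_le.mpr ?_
  rintro _ ⟨k, hk, i, rfl⟩
  simp only [SetLike.mem_coe, LinearMap.mem_ker, ContinuousLinearMap.coe_coe]
  rw [pairing_partialDeriv _ hφ.analytic]
  -- `B` is the scaling of `φ` relative to the chart, and `C k / B` is the value of `l k` at the
  -- chart point. Both are read off from coordinates of `φ`, so they are analytic.
  let B : (Fin m → ℂ) → ℂ := fun t => φ t (pivotIndex d c)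
  let C : Fin r → (Fin m → ℂ) → ℂ := fun k t => ∑ j, l k j * φ t (tupleIndex n d
      (Function.update (fun k _ => c k) k (Function.update (fun _ => c k) 0 j)))
  have han : ∀ J, AnalyticAt ℂ (fun t => φ t J) 0 := fun J =>
    ((ContinuousLinearMap.proj (R := ℂ) (φ := fun _ : MultiIndex n d => ℂ) J).analyticAt _).comp
      hφ.analytic
  have hB : AnalyticAt ℂ B 0 := han _
  have hC : ∀ k, AnalyticAt ℂ (C k) 0 := fun k =>
    Finset.analyticAt_fun_sum _ fun j _ => analyticAt_const.mul (han _)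
  have hmon : ∀ (ν : ℂ) (τ : ChartIndex c → ℂ) (t : Fin m → ℂ),
      φ t = ν • monomials n d (chart c τ) →
      B t = ν ∧ (∀ k, C k t = ν * ∑ j, l k j * chart c τ k j) ∧
      pairing (formCoeff n d fun k _ => l k) (φ t) =
        ν * ∏ k, (∑ j, l k j * chart c τ k j) ^ d k := by
    intro ν τ t ht
    refine ⟨?_, fun k => ?_, ?_⟩
    · simp [B, ht, monomials_pivotIndex]
    · simp only [C, ht, Pi.smul_apply, smul_eq_mul, monomials_tupleIndex_update, Finset.mul_sum]
      exact Finset.sum_congr rfl fun j _ => by ring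
    · rw [ht, map_smul, pairing_apply, sum_formCoeff_mul_monomials]
      simp
  obtain ⟨h0, hbase⟩ := hφ.base
  rw [Projectivization.mk_eq_mk_iff'] at hbase
  obtain ⟨ν₀, hν₀⟩ := hbase
  have hν₀' : ν₀ ≠ 0 := by
    rintro rfl
    exact h0 (by rw [← hν₀, zero_smul])
  obtain ⟨hB0, hC0, -⟩ := hmon ν₀ t₀ 0 hν₀.symm
  have hBne : B 0 ≠ 0 := by rwa [hB0]
  have hq : ∀ k, AnalyticAt ℂ (fun t => C k t / B t) 0 := fun k => (hC k).div hB hBne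
  have hev : (pairing (formCoeff n d fun k _ => l k) ∘ φ) =ᶠ[𝓝 0]
      fun t => (C k₀ t / B t) ^ d k₀ •
        (B t * ∏ k ∈ Finset.univ.erase k₀, (C k t / B t) ^ d k) := by
    filter_upwards [hφ.mem, hB.continuousAt.eventually_ne hBne] with t ht htB
    obtain ⟨ht0, htX⟩ := ht
    obtain ⟨ν, τ, hν, hτ⟩ := exists_eq_smul_chart d c ht0 htX htB
    obtain ⟨h1, h2, h3⟩ := hmon ν τ t hτ
    simp only [Function.comp_apply, h3, h1, h2, mul_div_cancel_left₀ _ hν]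
    rw [← Finset.mul_prod_erase _ _ (Finset.mem_univ k₀), smul_eq_mul]
    ring
  rw [iteratedFDeriv_pow_smul_eq_zero (hq k₀) (by simp [hC0, hk₀]) (d k₀)
    (hB.mul (Finset.analyticAt_fun_prod _ fun k _ => (hq k).pow (d k))) hev k (by omega)]
  rfl

end

/-! ### Forms of maximal multiplicity on a single projective space -/

section

variable {r : ℕ} {n : Fin r → ℕ} (d : Fin r → ℕ)

/-- The monomial with index `J` as a polynomial in all the variables. -/
def monomialPoly (J : MultiIndex n d) : MvPolynomial ((k : Fin r) × Fin (n k + 1)) ℂ :=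
  ∏ k, ((J k : Multiset (Fin (n k + 1))).map fun j => MvPolynomial.X ⟨k, j⟩).prod

theorem eval_monomialPoly (J : MultiIndex n d) (x : (k : Fin r) × Fin (n k + 1) → ℂ) :
    MvPolynomial.eval x (monomialPoly d J) = monomials n d (fun k j => x ⟨k, j⟩) J := by
  simp only [monomialPoly, monomials, map_prod, map_multiset_prod, Multiset.map_map]
  refine Finset.prod_congr rfl fun k _ => ?_
  congr 2
  ext j
  simp

/-- The form with coefficients `a`. -/
def form (a : MultiIndex n d → ℂ) : MvPolynomial ((k : Fin r) × Fin (n k + 1)) ℂ :=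
  ∑ J, MvPolynomial.C (a J) * monomialPoly d J

theorem eval_form (a : MultiIndex n d → ℂ) (x : (k : Fin r) × Fin (n k + 1) → ℂ) :
    MvPolynomial.eval x (form d a) = pairing a (monomials n d fun k j => x ⟨k, j⟩) := by
  simp [form, eval_monomialPoly, pairing_apply]

theorem exists_pairing_chartMap_eq_pow_mul (c : (k : Fin r) → Fin (n k + 1))
    (t₀ : ChartIndex c → ℂ) (a : MultiIndex n d → ℂ) (s : ℕ)
    (h : ∀ k < s, ∀ i : Fin k → Fin _, pairing a (partialDeriv (chartMap d c t₀) i) = 0)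
    (v : Fin (Fintype.card (ChartIndex c)) → ℂ) :
    ∃ g : ℂ → ℂ, AnalyticAt ℂ g 0 ∧
      ∀ᶠ z in 𝓝 0, pairing a (chartMap d c t₀ (z • v)) = z ^ s * g z := by
  have hA : ∀ t, AnalyticAt ℂ (pairing a ∘ chartMap d c t₀) t := fun t =>
    ((pairing a).analyticAt _).comp (analyticAt_chartMap d c t₀ t)
  have hCD : ∀ k : ℕ, ContDiff ℂ k (pairing a ∘ chartMap d c t₀) := fun k =>
    contDiff_iff_contDiffAt.mpr fun t => (hA t).contDiffAt
  -- A multilinear map is determined by its values on basis vectors, here the mixed partial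
  -- derivatives.
  have h0 : ∀ k < s, iteratedFDeriv ℂ k (pairing a ∘ chartMap d c t₀) 0 = 0 := by
    intro k hk
    apply ContinuousMultilinearMap.toMultilinearMap_injective
    refine Module.Basis.ext_multilinear (fun _ => Pi.basisFun ℂ _) fun i => ?_
    have := h k hk i
    rw [pairing_partialDeriv _ (analyticAt_chartMap d c t₀ 0)] at this
    simpa using this
  let L : ℂ →L[ℂ] (Fin (Fintype.card (ChartIndex c)) → ℂ) :=
    (ContinuousLinearMap.id ℂ ℂ).smulRight v
  have hL : AnalyticAt ℂ ((pairing a ∘ chartMap d c t₀) ∘ L) 0 := (hA _).comp (L.analyticAt 0)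
  have hord : (s : ℕ∞) ≤ analyticOrderAt ((pairing a ∘ chartMap d c t₀) ∘ L) 0 := by
    rw [natCast_le_analyticOrderAt_iff_iteratedDeriv_eq_zero hL]
    intro k hk
    rw [iteratedDeriv_eq_iteratedFDeriv, L.iteratedFDeriv_comp_right (hCD k) 0 le_rfl, map_zero,
      h0 k hk]
    simp
  obtain ⟨g, hg, hev⟩ := (natCast_le_analyticOrderAt hL).mp hord
  refine ⟨g, hg, ?_⟩
  filter_upwards [hev] with z hz
  simpa [L] using hz

section Veronese

variable [NeZero r] [Subsingleton (Fin r)]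

theorem form_ne_zero {a : MultiIndex n d → ℂ} (ha : a ≠ 0) : form d a ≠ 0 := by
  classical
  obtain ⟨J, hJ⟩ := Function.ne_iff.mp ha
  let e : MultiIndex n d → ((k : Fin r) × Fin (n k + 1) →₀ ℕ) := fun J =>
    Multiset.toFinsupp ((J 0 : Multiset (Fin (n 0 + 1))).map (Sigma.mk 0))
  have he : Function.Injective e := by
    intro J J' h
    have h1 := Multiset.map_injective sigma_mk_injective (Multiset.toFinsupp.injective h)
    ext k : 1
    obtain rfl := Subsingleton.elim 0 k
    exact Sym.coe_injective h1
  have hmon : ∀ J, monomialPoly d J = MvPolynomial.monomial (e J) 1 := by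
    intro J
    rw [monomialPoly, Fintype.prod_subsingleton _ 0]
    simp only [e]
    induction (J 0 : Multiset (Fin (n 0 + 1))) using Multiset.induction_on with
    | empty => simp
    | cons j s ih =>
      rw [Multiset.map_cons, Multiset.prod_cons, ih, Multiset.map_cons, ← Multiset.singleton_add,
        map_add, Multiset.toFinsupp_singleton, MvPolynomial.X, MvPolynomial.monomial_mul, one_mul]
  intro h0
  apply hJ
  have := congrArg (MvPolynomial.coeff (e J)) h0
  simpa [form, hmon, MvPolynomial.coeff_sum, MvPolynomial.coeff_C_mul, MvPolynomial.coeff_monomial,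
    he.eq_iff] using this

/-- By homogeneity, the value at `v + w • chart c t₀` is `w ^ d 0` times the value near the chart
point, at displacement of order `w⁻¹`. Vanishing to order `d 0` there cancels the power, so this
entire function of `w` has a finite limit at infinity and is constant by Liouville. -/
theorem pairing_monomials_add_smul (c : (k : Fin r) → Fin (n k + 1))
    (t₀ : ChartIndex c → ℂ) (a : MultiIndex n d → ℂ)
    (h : ∀ k < d 0, ∀ i : Fin k → Fin _, pairing a (partialDeriv (chartMap d c t₀) i) = 0)
    (v : (k : Fin r) → Fin (n k + 1) → ℂ) (w : ℂ) :
    pairing a (monomials n d (v + w • chart c t₀)) = pairing a (monomials n d v) := by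
  have key : ∀ v : (k : Fin r) → Fin (n k + 1) → ℂ, (∀ k, v k (c k) = 0) → ∀ w : ℂ,
      pairing a (monomials n d (v + w • chart c t₀)) = pairing a (monomials n d v) := by
    intro v hv
    let G : ℂ → ℂ := fun w => pairing a (monomials n d (v + w • chart c t₀))
    have hG : Differentiable ℂ G := by
      have : G = (fun x => MvPolynomial.eval x (form d a)) ∘
          fun w i => v i.1 i.2 + w * chart c t₀ i.1 i.2 := by
        ext w
        simp only [Function.comp_apply, eval_form]
        rfl
      rw [this]
      refine Differentiable.comp (fun x => (hasFDerivAt_eval _ x).differentiableAt) ?_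
      fun_prop
    obtain ⟨v', hv'⟩ : ∃ v' : ChartIndex c → ℂ, ∀ i, v' i = v i.1 i.2 := ⟨_, fun _ => rfl⟩
    obtain ⟨g, hg, hev⟩ := exists_pairing_chartMap_eq_pow_mul d c t₀ a (d 0) h
      (fun j => v' ((Fintype.equivFin (ChartIndex c)).symm j))
    have hinv : Filter.Tendsto (fun w : ℂ => w⁻¹) (Filter.cocompact ℂ) (𝓝 0) := by
      rw [← Metric.cobounded_eq_cocompact]
      exact Filter.tendsto_inv₀_cobounded
    have hlim : Filter.Tendsto G (Filter.cocompact ℂ) (𝓝 (g 0)) := by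
      refine (hg.continuousAt.tendsto.comp hinv).congr' ?_
      have hne : ∀ᶠ w : ℂ in Filter.cocompact ℂ, w ≠ 0 := by
        rw [← Metric.cobounded_eq_cocompact]
        exact Bornology.eventually_ne_cobounded 0
      filter_upwards [hinv.eventually hev, hne] with w hw hw0
      have e1 : v + w • chart c t₀ = fun k => w • (chart c (fun i => t₀ i +
          (w⁻¹ • fun j => v' ((Fintype.equivFin (ChartIndex c)).symm j))
            (Fintype.equivFin _ i))) k := by
        ext k j
        simp only [Pi.add_apply, Pi.smul_apply, smul_eq_mul, chart]
        split_ifs with hj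
        · rw [hj, hv, zero_add]
        · rw [Equiv.symm_apply_apply, hv', mul_add, mul_inv_cancel_left₀ hw0, add_comm]
      simp only [Function.comp_apply, G]
      rw [e1, monomials_smul, map_smul, Fintype.prod_subsingleton _ 0]
      have e2 := hw
      rw [chartMap] at e2
      rw [e2, smul_eq_mul, ← mul_assoc, ← mul_pow, mul_inv_cancel₀ hw0, one_pow, one_mul]
    intro w
    have h1 := hG.apply_eq_of_tendsto_cocompact w hlim
    have h2 := hG.apply_eq_of_tendsto_cocompact 0 hlim
    have h3 : G 0 = pairing a (monomials n d v) := by simp [G]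
    rw [← h3, h2, ← h1]
  -- A multiple of the chart vector removes the pivot coordinate of `v`, as `key` requires.
  obtain ⟨v₀, α, hv₀, rfl⟩ : ∃ (v₀ : (k : Fin r) → Fin (n k + 1) → ℂ) (α : ℂ),
      (∀ k, v₀ k (c k) = 0) ∧ v = v₀ + α • chart c t₀ := by
    refine ⟨v - v 0 (c 0) • chart c t₀, v 0 (c 0), fun k => ?_, by simp⟩
    obtain rfl := Subsingleton.elim 0 k
    simp
  rw [add_assoc, ← add_smul, key v₀ hv₀, key v₀ hv₀]

theorem eq_zero_of_pairing_partialDeriv_eq_zero (hd : d 0 ≠ 0) {κ : Type}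
    (c : κ → (k : Fin r) → Fin (n k + 1)) (t : ∀ i, ChartIndex (c i) → ℂ)
    (hspan : Submodule.span ℂ (Set.range fun i => chart (c i) (t i)) = ⊤)
    (a : MultiIndex n d → ℂ)
    (h : ∀ i, ∀ k < d 0, ∀ j : Fin k → Fin _,
      pairing a (partialDeriv (chartMap d (c i) (t i)) j) = 0) : a = 0 := by
  have hz : pairing a (monomials n d 0) = 0 := by
    have : (0 : (k : Fin r) → Fin (n k + 1) → ℂ) = fun k => (0 : ℂ) • (0 : Fin (n k + 1) → ℂ) := by
      ext; simp
    rw [this, monomials_smul, Fintype.prod_subsingleton _ 0, zero_pow hd, zero_smul, map_zero]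
  have key : ∀ u ∈ Submodule.span ℂ (Set.range fun i => chart (c i) (t i)), ∀ v,
      pairing a (monomials n d (v + u)) = pairing a (monomials n d v) := by
    intro u hu
    induction hu using Submodule.closure_induction with
    | smul_mem w x hx =>
      obtain ⟨i, rfl⟩ := hx
      intro v
      exact pairing_monomials_add_smul d (c i) (t i) a (h i) v w
    | zero => simp
    | add x y _ _ hx hy => intro v; rw [← add_assoc, hy, hx]
  by_contra ha
  refine form_ne_zero d ha (MvPolynomial.funext fun x => ?_)
  rw [eval_form, map_zero, ← hz, ← zero_add (fun k j => x ⟨k, j⟩)]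
  exact key _ (by rw [hspan]; trivial) 0

end Veronese

end

/-! ### Zariski density and finite sets -/

section

open MvPolynomial in
theorem IsWeightedHomogeneous.eval_mul {κ ι : Type} [Fintype κ] [DecidableEq κ] [Fintype ι]
    {F : MvPolynomial (κ × ι) ℂ} {m : κ → ℕ}
    (hF : ∀ a, F.IsWeightedHomogeneous (fun b : κ × ι => if b.1 = a then (1 : ℕ) else 0) (m a))
    (μ : κ → ℂ) (z : κ × ι → ℂ) :
    eval (fun b => μ b.1 * z b) F = (∏ a, μ a ^ m a) * eval z F := by
  rw [eval_eq', eval_eq', Finset.mul_sum]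
  refine Finset.sum_congr rfl fun e he => ?_
  simp only [mul_pow, Finset.prod_mul_distrib]
  have : ∏ b, μ b.1 ^ e b = ∏ a, μ a ^ m a := by
    rw [Fintype.prod_prod_type]
    refine Finset.prod_congr rfl fun a _ => ?_
    have h := hF a (mem_support_iff.mp he)
    change ∏ y, μ a ^ e (a, y) = _
    rw [Finset.prod_pow_eq_pow_sum, ← h]
    congr 1
    rw [Finsupp.weight_apply, Finsupp.sum_fintype _ _ (by simp), Fintype.sum_prod_type]
    simp only [smul_eq_mul, mul_ite, mul_one, mul_zero]
    rw [Finset.sum_eq_single a]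
    · simp
    · intro b _ hb
      simp [hb]
    · simp
  rw [this]
  ring

/-- The restriction of a polynomial to the line through `x` and `y`. -/
def lineRestrict {σ : Type} (x y : σ → ℂ) (F : MvPolynomial σ ℂ) : Polynomial ℂ :=
  MvPolynomial.aeval (fun i => Polynomial.C (x i) + Polynomial.X * Polynomial.C (y i - x i)) F

theorem eval_lineRestrict {σ : Type} (x y : σ → ℂ) (F : MvPolynomial σ ℂ) (s : ℂ) :
    (lineRestrict x y F).eval s = MvPolynomial.eval (fun i => x i + s * (y i - x i)) F := by
  have : (Polynomial.evalRingHom s).comp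
      (MvPolynomial.aeval (R := ℂ)
        (fun i => Polynomial.C (x i) + Polynomial.X * Polynomial.C (y i - x i))).toRingHom =
      MvPolynomial.eval (fun i => x i + s * (y i - x i)) := by
    refine MvPolynomial.ringHom_ext (fun c => ?_) fun i => ?_ <;> simp
  exact congrArg (fun h : MvPolynomial σ ℂ →+* ℂ => h F) this

/-- Irreducibility of affine space, seen on a line: both restrictions are nonzero polynomials in one
variable, hence so is their product. The density statements below rest on this. -/
theorem exists_line_point {σ : Type} (x y : σ → ℂ) {F G : MvPolynomial σ ℂ}
    (hF : MvPolynomial.eval x F ≠ 0) (hG : MvPolynomial.eval y G ≠ 0) :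
    ∃ s : ℂ, MvPolynomial.eval (fun i => x i + s * (y i - x i)) F ≠ 0 ∧
      MvPolynomial.eval (fun i => x i + s * (y i - x i)) G ≠ 0 := by
  have h1 : lineRestrict x y F ≠ 0 := fun h => hF (by
    have := eval_lineRestrict x y F 0
    rw [h] at this
    simpa using this.symm)
  have h2 : lineRestrict x y G ≠ 0 := fun h => hG (by
    have := eval_lineRestrict x y G 1
    rw [h] at this
    simpa using this.symm)
  by_contra! hcon
  refine mul_ne_zero h1 h2 (Polynomial.funext fun s => ?_)
  rw [Polynomial.eval_mul, eval_lineRestrict, eval_lineRestrict, Polynomial.eval_zero]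
  by_cases h : MvPolynomial.eval (fun i => x i + s * (y i - x i)) F = 0
  · rw [h, zero_mul]
  · rw [hcon s h, mul_zero]

theorem exists_homogeneous_of_isOpen {ι : Type} {O : Set (ℙ ℂ (ι → ℂ))}
    (hO : IsOpen[zariski ι] O) {p : ℙ ℂ (ι → ℂ)} (hp : p ∈ O) :
    ∃ (m : ℕ) (F : MvPolynomial ι ℂ), F.IsHomogeneous m ∧ MvPolynomial.eval p.rep F ≠ 0 ∧
      ∀ q : ℙ ℂ (ι → ℂ), MvPolynomial.eval q.rep F ≠ 0 → q ∈ O := by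
  induction hO with
  | basic U hU =>
    obtain ⟨m, F, hF, rfl⟩ := hU
    exact ⟨m, F, hF, hp, fun q hq => hq⟩
  | univ => exact ⟨0, 1, MvPolynomial.isHomogeneous_one _ _, by simp, fun _ _ => trivial⟩
  | inter U V _ _ hU hV =>
    obtain ⟨m, F, hF, hpF, hFU⟩ := hU hp.1
    obtain ⟨m', F', hF', hpF', hFV⟩ := hV hp.2
    refine ⟨_, _, hF.mul hF', by simpa using ⟨hpF, hpF'⟩, fun q hq => ?_⟩
    rw [map_mul] at hq
    exact ⟨hFU q (left_ne_zero_of_mul hq), hFV q (right_ne_zero_of_mul hq)⟩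
  | sUnion S _ hS =>
    obtain ⟨U, hU, hpU⟩ := hp
    obtain ⟨m, F, hF, hpF, hFU⟩ := hS U hU hpU
    exact ⟨m, F, hF, hpF, fun q hq => ⟨U, hU, hFU q hq⟩⟩

theorem exists_multihomogeneous_of_isOpen {κ ι : Type} [DecidableEq κ]
    {O : Set (κ → ℙ ℂ (ι → ℂ))} (hO : IsOpen[zariskiProd κ ι] O) {p : κ → ℙ ℂ (ι → ℂ)}
    (hp : p ∈ O) :
    ∃ (m : κ → ℕ) (F : MvPolynomial (κ × ι) ℂ),
      (∀ a, F.IsWeightedHomogeneous (fun b : κ × ι => if b.1 = a then (1 : ℕ) else 0) (m a)) ∧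
      MvPolynomial.eval (fun b : κ × ι => (p b.1).rep b.2) F ≠ 0 ∧
      ∀ q : κ → ℙ ℂ (ι → ℂ), MvPolynomial.eval (fun b : κ × ι => (q b.1).rep b.2) F ≠ 0 → q ∈ O := by
  induction hO with
  | basic U hU =>
    obtain ⟨m, F, hF, rfl⟩ := hU
    exact ⟨m, F, hF, hp, fun q hq => hq⟩
  | univ =>
    exact ⟨0, 1, fun a => MvPolynomial.isWeightedHomogeneous_one _ _, by simp, fun _ _ => trivial⟩
  | inter U V _ _ hU hV =>
    obtain ⟨m, F, hF, hpF, hFU⟩ := hU hp.1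
    obtain ⟨m', F', hF', hpF', hFV⟩ := hV hp.2
    refine ⟨m + m', _, fun a => (hF a).mul (hF' a), by simpa using ⟨hpF, hpF'⟩, fun q hq => ?_⟩
    rw [map_mul] at hq
    exact ⟨hFU q (left_ne_zero_of_mul hq), hFV q (right_ne_zero_of_mul hq)⟩
  | sUnion S _ hS =>
    obtain ⟨U, hU, hpU⟩ := hp
    obtain ⟨m, F, hF, hpF, hFU⟩ := hS U hU hpU
    exact ⟨m, F, hF, hpF, fun q hq => ⟨U, hU, hFU q hq⟩⟩

theorem exists_rep_mk_eq_smul {V : Type} [AddCommGroup V] [Module ℂ V] {v : V} (hv : v ≠ 0) :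
    ∃ μ : ℂ, μ ≠ 0 ∧ (Projectivization.mk ℂ v hv).rep = μ • v := by
  obtain ⟨μ, hμ⟩ := Projectivization.exists_smul_eq_mk_rep ℂ v hv
  exact ⟨μ, μ.ne_zero, hμ.symm⟩

theorem linear_subset_closure {ι : Type} (W : Submodule ℂ (ι → ℂ)) {m : ℕ}
    {G : MvPolynomial ι ℂ} (hG : G.IsHomogeneous m) {a : ι → ℂ} (ha : a ∈ W)
    (haG : MvPolynomial.eval a G ≠ 0) :
    {q : ℙ ℂ (ι → ℂ) | q.rep ∈ W} ⊆
      closure[zariski ι] ({q | MvPolynomial.eval q.rep G ≠ 0} ∩ {q | q.rep ∈ W}) := by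
  intro q hq
  let _ := zariski ι
  refine mem_closure_iff.mpr fun O hO hqO => ?_
  obtain ⟨k, F, hF, hqF, hFO⟩ := exists_homogeneous_of_isOpen hO hqO
  obtain ⟨j, hj⟩ := Function.ne_iff.mp q.rep_nonzero
  -- The factor `X j` keeps the new point away from the origin.
  obtain ⟨s, hs1, hs2⟩ := exists_line_point q.rep a (F := F * MvPolynomial.X j) (G := G)
    (by simpa using ⟨hqF, hj⟩) haG
  have hbW : (fun i => q.rep i + s * (a i - q.rep i)) ∈ W :=
    W.add_mem hq (W.smul_mem s (W.sub_mem ha hq))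
  set b : ι → ℂ := fun i => q.rep i + s * (a i - q.rep i) with hb
  rw [map_mul, MvPolynomial.eval_X] at hs1
  have hb0 : b ≠ 0 := fun h => right_ne_zero_of_mul hs1 (congrFun h j)
  obtain ⟨μ, hμ0, hμ⟩ := exists_rep_mk_eq_smul hb0
  refine ⟨Projectivization.mk ℂ b hb0, hFO _ ?_, ?_, ?_⟩
  · rw [hμ, IsHomogeneous.eval_smul hF]
    exact mul_ne_zero (pow_ne_zero _ hμ0) (left_ne_zero_of_mul hs1)
  · change _ ≠ _
    rw [hμ, IsHomogeneous.eval_smul hG]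
    exact mul_ne_zero (pow_ne_zero _ hμ0) hs2
  · change _ ∈ W
    rw [hμ]
    exact W.smul_mem _ hbW

theorem isClosed_singleton_zariski {ι : Type} (p : ℙ ℂ (ι → ℂ)) : IsClosed[zariski ι] {p} := by
  let _ := zariski ι
  rw [← isOpen_compl_iff]
  have : ({p}ᶜ : Set (ℙ ℂ (ι → ℂ))) = ⋃ ij : ι × ι, {q | MvPolynomial.eval q.rep
      (MvPolynomial.C (p.rep ij.1) * MvPolynomial.X ij.2 -
        MvPolynomial.C (p.rep ij.2) * MvPolynomial.X ij.1) ≠ 0} := by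
    ext q
    simp only [Set.mem_compl_iff, Set.mem_singleton_iff, Set.mem_iUnion, Set.mem_ofPred_eq]
    rw [← not_forall_not, not_iff_not]
    constructor
    · rintro rfl ij
      simp [mul_comm]
    · intro h
      obtain ⟨j, hj⟩ := Function.ne_iff.mp p.rep_nonzero
      rw [← q.mk_rep, ← p.mk_rep, Projectivization.mk_eq_mk_iff']
      refine ⟨q.rep j / p.rep j, ?_⟩
      ext i
      have := h (j, i)
      simp only [map_sub, map_mul, MvPolynomial.eval_C, MvPolynomial.eval_X, not_not,
        sub_eq_zero] at this
      rw [Pi.smul_apply, smul_eq_mul, div_mul_eq_mul_div, div_eq_iff hj, mul_comm (q.rep i), this,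
        mul_comm]
  rw [this]
  refine isOpen_iUnion fun ij => TopologicalSpace.isOpen_generateFrom_of_mem
    ⟨1, _, ?_, rfl⟩
  refine MvPolynomial.IsHomogeneous.sub ?_ ?_ <;>
  exact (MvPolynomial.isHomogeneous_X _ _).C_mul _

theorem topologicalKrullDim_zariski_finite {ι : Type} {Y : Set (ℙ ℂ (ι → ℂ))} (hY : Y.Finite) :
    @topologicalKrullDim Y ((zariski ι).induced Subtype.val) ≤ 0 := by
  let _ := zariski ι
  have : T1Space (ℙ ℂ (ι → ℂ)) := ⟨isClosed_singleton_zariski⟩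
  have : Finite Y := hY
  exact topologicalKrullDim_zero_of_discreteTopology Y

end

section

variable {r : ℕ} {n : Fin r → ℕ} (d : Fin r → ℕ)

/-! ### General points of the Segre-Veronese variety -/

/-- The matrix of the first `N` coordinates in the `k`-th factor of `N` points of an affine
chart. -/
def coordMatrix {N : ℕ} (h : ∀ k, N ≤ n k + 1)
    (t : Fin N → ChartIndex (fun k => (0 : Fin (n k + 1))) → ℂ) (k : Fin r) :
    Matrix (Fin N) (Fin N) ℂ :=
  Matrix.of fun i j => chart (fun k => (0 : Fin (n k + 1))) (t i) k (Fin.castLE (h k) j)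

/-- Points with independent coordinate vectors in all factors. -/
def InGeneralPosition {N : ℕ} (h : ∀ k, N ≤ n k + 1)
    (p : Fin N → ℙ ℂ (MultiIndex n d → ℂ)) : Prop :=
  ∃ t : Fin N → ChartIndex (fun k => (0 : Fin (n k + 1))) → ℂ,
    (∀ i, p i = Projectivization.mk ℂ (monomials n d (chart _ (t i)))
      (monomials_ne_zero n d (chart_ne_zero _ (t i)))) ∧ ∀ k, (coordMatrix h t k).det ≠ 0

theorem eval_aeval_monomialPoly {κ : Type} (G : MvPolynomial (κ × MultiIndex n d) ℂ)
    (y : κ × ((k : Fin r) × Fin (n k + 1)) → ℂ) :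
    MvPolynomial.eval y (MvPolynomial.aeval (fun b : κ × MultiIndex n d =>
      MvPolynomial.rename (Prod.mk b.1) (monomialPoly d b.2)) G) = MvPolynomial.eval
      (fun b => monomials n d (fun k j => y (b.1, ⟨k, j⟩)) b.2) G := by
  have : (MvPolynomial.eval y).comp (MvPolynomial.aeval (R := ℂ)
      (fun b : κ × MultiIndex n d =>
        MvPolynomial.rename (Prod.mk b.1) (monomialPoly d b.2))).toRingHom =
      MvPolynomial.eval (fun b => monomials n d (fun k j => y (b.1, ⟨k, j⟩)) b.2) := by
    refine MvPolynomial.ringHom_ext (fun c => by simp) fun b => ?_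
    simp [MvPolynomial.eval_rename, eval_monomialPoly, Function.comp_def]
  exact congrArg (fun h : MvPolynomial (κ × MultiIndex n d) ℂ →+* ℂ => h G) this

theorem eval_rep_ne_zero_iff {κ ι : Type} [Fintype κ] [DecidableEq κ] [Fintype ι]
    {m : κ → ℕ} {G : MvPolynomial (κ × ι) ℂ}
    (hG : ∀ a, G.IsWeightedHomogeneous (fun b : κ × ι => if b.1 = a then (1 : ℕ) else 0) (m a))
    {p : κ → ℙ ℂ (ι → ℂ)} {z : κ → ι → ℂ} {hz : ∀ i, z i ≠ 0}
    (hp : ∀ i, p i = Projectivization.mk ℂ (z i) (hz i)) :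
    MvPolynomial.eval (fun b : κ × ι => (p b.1).rep b.2) G ≠ 0 ↔
      MvPolynomial.eval (fun b : κ × ι => z b.1 b.2) G ≠ 0 := by
  choose μ hμ0 hμ using fun i => exists_rep_mk_eq_smul (hz i)
  simp only [hp, hμ, Pi.smul_apply, smul_eq_mul]
  rw [IsWeightedHomogeneous.eval_mul hG μ fun b => z b.1 b.2, mul_ne_zero_iff]
  exact and_iff_right (Finset.prod_ne_zero_iff.mpr fun i _ => pow_ne_zero _ (hμ0 i))

/-- Pulled back along the monomial map, open conditions on tuples of points become polynomial
conditions on an affine space. There a line joins a given tuple to `x`, so one nonvanishing value of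
`Q` gives density. -/
theorem holdsGenerally_of_multihomogeneous {κ : Type} [Fintype κ] [DecidableEq κ]
    {m : κ → ℕ} {Q : MvPolynomial (κ × MultiIndex n d) ℂ}
    (hQ : ∀ a, Q.IsWeightedHomogeneous
      (fun b : κ × MultiIndex n d => if b.1 = a then (1 : ℕ) else 0) (m a))
    {x : κ × ((k : Fin r) × Fin (n k + 1)) → ℂ}
    (hx : MvPolynomial.eval (fun b => monomials n d (fun k j => x (b.1, ⟨k, j⟩)) b.2) Q ≠ 0)
    {P : (κ → ℙ ℂ (MultiIndex n d → ℂ)) → Prop}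
    (hP : ∀ p : κ → ℙ ℂ (MultiIndex n d → ℂ), (∀ i, p i ∈ segreVeronese n d) →
      MvPolynomial.eval (fun b : κ × MultiIndex n d => (p b.1).rep b.2) Q ≠ 0 → P p) :
    HoldsGenerally (zariskiProd κ (MultiIndex n d)) {p | ∀ i, p i ∈ segreVeronese n d} P := by
  refine ⟨{p | MvPolynomial.eval (fun b : κ × MultiIndex n d => (p b.1).rep b.2) Q ≠ 0},
    TopologicalSpace.isOpen_generateFrom_of_mem ⟨_, _, hQ, rfl⟩, ?_, fun p hp => hP p hp.2 hp.1⟩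
  intro p hp
  let _ := zariskiProd κ (MultiIndex n d)
  refine mem_closure_iff.mpr fun O hO hpO => ?_
  obtain ⟨l, F, hF, hpF, hFO⟩ := exists_multihomogeneous_of_isOpen hO hpO
  choose z hz hzp using hp
  choose c hc using fun i k => Function.ne_iff.mp (hz i k)
  have hpF' := (eval_rep_ne_zero_iff hF hzp).mp hpF
  let pull : MvPolynomial (κ × MultiIndex n d) ℂ →
      MvPolynomial (κ × ((k : Fin r) × Fin (n k + 1))) ℂ :=
    MvPolynomial.aeval fun b => MvPolynomial.rename (Prod.mk b.1) (monomialPoly d b.2)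
  have h1 : MvPolynomial.eval (fun b : κ × ((k : Fin r) × Fin (n k + 1)) => z b.1 b.2.1 b.2.2)
      (pull F * ∏ i, ∏ k, MvPolynomial.X (i, ⟨k, c i k⟩)) ≠ 0 := by
    rw [map_mul, eval_aeval_monomialPoly]
    refine mul_ne_zero hpF' ?_
    simp only [map_prod, MvPolynomial.eval_X]
    exact Finset.prod_ne_zero_iff.mpr fun i _ => Finset.prod_ne_zero_iff.mpr fun k _ => hc i k
  have h2 : MvPolynomial.eval x (pull Q) ≠ 0 := by
    rw [eval_aeval_monomialPoly]
    exact hx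
  obtain ⟨s, hs1, hs2⟩ := exists_line_point _ _ h1 h2
  generalize (fun b : κ × ((k : Fin r) × Fin (n k + 1)) => z b.1 b.2.1 b.2.2 +
    s * (x b - z b.1 b.2.1 b.2.2)) = y at hs1 hs2
  rw [map_mul, eval_aeval_monomialPoly] at hs1
  rw [eval_aeval_monomialPoly] at hs2
  have hyne : ∀ (i : κ) (k : Fin r), (fun j => y (i, ⟨k, j⟩)) ≠ 0 := by
    intro i k h0
    apply right_ne_zero_of_mul hs1
    simp only [map_prod, MvPolynomial.eval_X]
    exact Finset.prod_eq_zero (Finset.mem_univ i) (Finset.prod_eq_zero (Finset.mem_univ k)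
      (congrFun h0 (c i k)))
  let q : κ → ℙ ℂ (MultiIndex n d → ℂ) := fun i =>
    Projectivization.mk ℂ (monomials n d fun k j => y (i, ⟨k, j⟩)) (monomials_ne_zero n d (hyne i))
  have hq : ∀ i, q i = Projectivization.mk ℂ (monomials n d fun k j => y (i, ⟨k, j⟩))
    (monomials_ne_zero n d (hyne i)) := fun i => rfl
  have hqX : ∀ i, q i ∈ segreVeronese n d := fun i => ⟨fun k j => y (i, ⟨k, j⟩), hyne i, hq i⟩
  exact ⟨q, hFO q ((eval_rep_ne_zero_iff hF hq).mpr (left_ne_zero_of_mul hs1)),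
    (eval_rep_ne_zero_iff hQ hq).mpr hs2, hqX⟩

variable [∀ k, NeZero (d k)]

/-- A multihomogeneous polynomial whose non-vanishing forces points to be in general position. -/
def positionPoly {N : ℕ} (h : ∀ k, N ≤ n k + 1) : MvPolynomial (Fin N × MultiIndex n d) ℂ :=
  (∏ i, MvPolynomial.X (i, pivotIndex d (fun k => (0 : Fin (n k + 1))))) *
    ∏ k, (Matrix.of fun i j : Fin N => (MvPolynomial.X (i, tupleIndex n d
      (Function.update (fun _ _ => 0) k (Function.update (fun _ => 0) 0 (Fin.castLE (h k) j)))) :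
        MvPolynomial (Fin N × MultiIndex n d) ℂ)).det

theorem isWeightedHomogeneous_prod_X {κ ι : Type} [Fintype κ] [DecidableEq κ] (J : κ → ι) (a : κ) :
    (∏ i, (MvPolynomial.X (i, J i) : MvPolynomial (κ × ι) ℂ)).IsWeightedHomogeneous
      (fun b : κ × ι => if b.1 = a then (1 : ℕ) else 0) 1 := by
  have := MvPolynomial.IsWeightedHomogeneous.prod Finset.univ
    (fun i => (MvPolynomial.X (i, J i) : MvPolynomial (κ × ι) ℂ))
    (fun i => if i = a then (1 : ℕ) else 0)
    (w := fun b : κ × ι => if b.1 = a then (1 : ℕ) else 0)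
    (fun i _ => MvPolynomial.isWeightedHomogeneous_X ℂ _ (i, J i))
  simpa using this

theorem isWeightedHomogeneous_positionPoly {N : ℕ} (h : ∀ k, N ≤ n k + 1) (a : Fin N) :
    (positionPoly d h).IsWeightedHomogeneous
      (fun b : Fin N × MultiIndex n d => if b.1 = a then (1 : ℕ) else 0) (1 + r) := by
  refine (isWeightedHomogeneous_prod_X _ a).mul ?_
  have := MvPolynomial.IsWeightedHomogeneous.prod Finset.univ
    (fun k : Fin r => (Matrix.of fun i j : Fin N => (MvPolynomial.X (i, tupleIndex n d
      (Function.update (fun _ _ => 0) k (Function.update (fun _ => 0) 0 (Fin.castLE (h k) j)))) :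
        MvPolynomial (Fin N × MultiIndex n d) ℂ)).det) (fun _ => 1)
    (w := fun b : Fin N × MultiIndex n d => if b.1 = a then (1 : ℕ) else 0)
    (fun k _ => by
      -- After transposing, each term of the determinant is a product over the points `i`, hence of
      -- degree one in each.
      rw [← Matrix.det_transpose, Matrix.det_apply]
      refine MvPolynomial.IsWeightedHomogeneous.sum _ _ _ fun σ _ => ?_
      rw [Units.smul_def, zsmul_eq_mul]
      have h1 := MvPolynomial.isWeightedHomogeneous_C (R := ℂ)
        (fun b : Fin N × MultiIndex n d => if b.1 = a then (1 : ℕ) else 0)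
        ((Equiv.Perm.sign σ : ℤ) : ℂ)
      have h2 := h1.mul (isWeightedHomogeneous_prod_X (fun i => tupleIndex n d
        (Function.update (fun _ _ => 0) k
          (Function.update (fun _ => 0) 0 (Fin.castLE (h k) (σ i))))) a)
      simpa using h2)
  simpa using this

theorem eval_positionPoly {N : ℕ} (h : ∀ k, N ≤ n k + 1) (ν : Fin N → ℂ)
    (t : Fin N → ChartIndex (fun k => (0 : Fin (n k + 1))) → ℂ) :
    MvPolynomial.eval (fun b : Fin N × MultiIndex n d =>
      (ν b.1 • monomials n d (chart _ (t b.1))) b.2) (positionPoly d h) =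
      (∏ i, ν i) * ∏ k, ((∏ i, ν i) * (coordMatrix h t k).det) := by
  simp only [positionPoly, map_mul, map_prod, MvPolynomial.eval_X, Pi.smul_apply, smul_eq_mul,
    monomials_pivotIndex, mul_one]
  congr 1
  refine Finset.prod_congr rfl fun k _ => ?_
  rw [RingHom.map_det, ← Matrix.det_mul_column]
  congr 1
  ext i j
  simp only [RingHom.mapMatrix_apply, Matrix.map_apply, Matrix.of_apply, MvPolynomial.eval_X,
    coordMatrix]
  exact congrArg (ν i * ·) (monomials_tupleIndex_update d _ (t i) k _)

theorem inGeneralPosition_of_eval_positionPoly_ne_zero {N : ℕ} (h : ∀ k, N ≤ n k + 1)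
    {p : Fin N → ℙ ℂ (MultiIndex n d → ℂ)} (hp : ∀ i, p i ∈ segreVeronese n d)
    (hQ : MvPolynomial.eval (fun b : Fin N × MultiIndex n d => (p b.1).rep b.2)
      (positionPoly d h) ≠ 0) : InGeneralPosition d h p := by
  have hpiv : ∀ i, (p i).rep (pivotIndex d fun k => (0 : Fin (n k + 1))) ≠ 0 := by
    intro i hi
    apply hQ
    rw [positionPoly, map_mul, map_prod, Finset.prod_eq_zero (Finset.mem_univ i), zero_mul]
    rw [MvPolynomial.eval_X]
    exact hi
  choose ν t hν ht using fun i => exists_eq_smul_chart d (fun k => (0 : Fin (n k + 1)))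
    (p i).rep_nonzero (by rw [Projectivization.mk_rep]; exact hp i) (hpiv i)
  refine ⟨t, fun i => ?_, fun k hk => ?_⟩
  · rw [← (p i).mk_rep, Projectivization.mk_eq_mk_iff']
    exact ⟨ν i, (ht i).symm⟩
  · apply hQ
    simp only [ht]
    rw [eval_positionPoly, Finset.prod_eq_zero (Finset.mem_univ k), mul_zero]
    rw [hk, mul_zero]

theorem exists_eval_positionPoly_ne_zero {N : ℕ} (h : ∀ k, N ≤ n k + 1) :
    ∃ t : Fin N → ChartIndex (fun k => (0 : Fin (n k + 1))) → ℂ,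
      MvPolynomial.eval (fun b : Fin N × MultiIndex n d => monomials n d (chart _ (t b.1)) b.2)
        (positionPoly d h) ≠ 0 := by
  -- Points on rational normal curves: every coordinate matrix is the Vandermonde matrix of `0, …, N
  -- - 1`.
  refine ⟨fun i s => ((i : ℕ) : ℂ) ^ (s.2.1 : ℕ), ?_⟩
  have := eval_positionPoly d h (fun _ => 1)
    (fun i s => ((i : ℕ) : ℂ) ^ (s.2.1 : ℕ))
  simp only [one_smul, Finset.prod_const_one, one_mul] at this
  rw [this]
  refine Finset.prod_ne_zero_iff.mpr fun k _ => ?_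
  have hV : coordMatrix h (fun i s => ((i : ℕ) : ℂ) ^ (s.2.1 : ℕ)) k =
      Matrix.vandermonde fun i : Fin N => ((i : ℕ) : ℂ) := by
    ext i j
    simp only [coordMatrix, Matrix.of_apply, chart, Matrix.vandermonde_apply]
    split_ifs with hj
    · have : (j : ℕ) = 0 := by simpa using congrArg Fin.val hj
      rw [this, pow_zero]
    · rfl
  rw [hV, Matrix.det_vandermonde_ne_zero_iff]
  intro i j hij
  simpa [Fin.ext_iff] using hij

theorem holdsGenerally_inGeneralPosition {N : ℕ} (h : ∀ k, N ≤ n k + 1) :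
    HoldsGenerally (zariskiProd (Fin N) (MultiIndex n d)) {p | ∀ i, p i ∈ segreVeronese n d}
      (InGeneralPosition d h) := by
  obtain ⟨t, ht⟩ := exists_eval_positionPoly_ne_zero d h
  exact holdsGenerally_of_multihomogeneous d (isWeightedHomogeneous_positionPoly d h)
    (x := fun b => chart _ (t b.1) b.2.1 b.2.2) ht fun p hp hQ =>
      inGeneralPosition_of_eval_positionPoly_ne_zero d h hp hQ

end

/-! ### Separating forms and Bertini on a linear system -/

section

/-- A product of linear forms that vanishes at given points of a product of projective spaces but
not at another point. -/
theorem exists_separating_forms {ρ κ : Type} [DecidableEq ρ] [Nontrivial ρ] [Fintype κ]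
    [DecidableEq κ] {V : ρ → Type} [∀ k, AddCommGroup (V k)] [∀ k, Module ℂ (V k)]
    (y : κ → ∀ k, V k) (f : ∀ k, κ → Module.Dual ℂ (V k))
    (hf : ∀ k i j, f k i (y j k) = if i = j then 1 else 0) (z : ∀ k, V k) (hz : ∀ k, z k ≠ 0)
    (hzy : ¬ ∃ (i : κ) (α : ρ → ℂ), ∀ k, z k = α k • y i k) :
    ∃ l : ∀ k, Module.Dual ℂ (V k), (∀ k, l k (z k) ≠ 0) ∧ ∀ i, ∃ k, l k (y i k) = 0 := by
  have hdual : ∀ k (x : V k), x ≠ 0 → ∃ g : Module.Dual ℂ (V k), g x ≠ 0 := fun k x hx => by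
    by_contra! h
    exact hx ((Module.forall_dual_apply_eq_zero_iff ℂ x).mp h)
  by_cases hA : ∃ k, z k ≠ ∑ i, f k i (z k) • y i k
  · obtain ⟨k, hk⟩ := hA
    obtain ⟨g, hg⟩ := hdual k _ (sub_ne_zero.mpr hk)
    choose l hl using fun k => hdual k (z k) (hz k)
    -- `P` kills every `y i k` but not `z k`, so a single factor takes care of all the points.
    let P : V k →ₗ[ℂ] V k := LinearMap.id - ∑ i, (f k i).smulRight (y i k)
    have hP : ∀ x, P x = x - ∑ i, f k i x • y i k := fun x => by simp [P]
    refine ⟨Function.update l k (g ∘ₗ P), fun k' => ?_, fun i => ⟨k, ?_⟩⟩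
    · by_cases h : k' = k
      · subst h
        rw [Function.update_self, LinearMap.comp_apply, hP]
        exact hg
      · rw [Function.update_of_ne h]
        exact hl k'
    · rw [Function.update_self, LinearMap.comp_apply, hP]
      simp [hf]
  · push Not at hA
    have hne : ∀ k, ∃ i, f k i (z k) ≠ 0 := by
      intro k
      by_contra! h
      apply hz k
      rw [hA k]
      simp [h]
    -- Now each `z k` is a combination of the `y i k`. If every choice `s` of nonzero coefficients
    -- were constant, changing `s` in one factor would show that only one coefficient is nonzero,
    -- with the same index in all factors, contradicting `hzy`.
    obtain ⟨s, hs, k₁, k₂, hs12⟩ : ∃ s : ρ → κ, (∀ k, f k (s k) (z k) ≠ 0) ∧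
        ∃ k₁ k₂, s k₁ ≠ s k₂ := by
      choose s hs using hne
      by_contra! hcon
      obtain ⟨k₀⟩ : Nonempty ρ := inferInstance
      refine hzy ⟨s k₀, fun k => f k (s k₀) (z k), fun k => ?_⟩
      conv_lhs => rw [hA k]
      refine Finset.sum_eq_single _ (fun i _ hi => ?_) (by simp)
      suffices f k i (z k) = 0 by rw [this, zero_smul]
      by_contra h
      obtain ⟨k', hk'⟩ := exists_ne k
      have h1 := hcon (Function.update s k i) (fun k'' => by
        by_cases e : k'' = k
        · subst e
          rwa [Function.update_self]
        · rw [Function.update_of_ne e]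
          exact hs k'') k k'
      rw [Function.update_self, Function.update_of_ne hk', hcon s hs k' k₀] at h1
      exact hi h1
    refine ⟨fun k => f k (s k), hs, fun i => ?_⟩
    by_cases h : s k₁ = i
    · refine ⟨k₂, ?_⟩
      rw [hf, if_neg]
      rintro rfl
      exact hs12 h
    · exact ⟨k₁, by rw [hf, if_neg h]⟩

variable {r : ℕ} {n : Fin r → ℕ} (d : Fin r → ℕ)

/-- The linear forms dual to points with independent coordinate vectors. -/
theorem exists_dual_forms {N : ℕ} (h : ∀ k, N ≤ n k + 1)
    (t : Fin N → ChartIndex (fun k => (0 : Fin (n k + 1))) → ℂ)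
    (ht : ∀ k, (coordMatrix h t k).det ≠ 0) :
    ∃ f : ∀ k, Fin N → Module.Dual ℂ (Fin (n k + 1) → ℂ),
      (∀ k i j, f k i (chart (fun k => (0 : Fin (n k + 1))) (t j) k) = if i = j then 1 else 0) ∧
      ∀ k x j, ∑ i, f k i x * chart (fun k => (0 : Fin (n k + 1))) (t i) k (Fin.castLE (h k) j) =
        x (Fin.castLE (h k) j) := by
  let f : ∀ k, Fin N → Module.Dual ℂ (Fin (n k + 1) → ℂ) := fun k i =>
    ∑ j, (coordMatrix h t k)⁻¹ j i • LinearMap.proj (Fin.castLE (h k) j)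
  have hf : ∀ k i x, f k i x = ∑ j, (coordMatrix h t k)⁻¹ j i * x (Fin.castLE (h k) j) :=
    fun k i x => by simp [f]
  have hu : ∀ k, IsUnit (coordMatrix h t k).det := fun k => isUnit_iff_ne_zero.mpr (ht k)
  refine ⟨f, fun k i j => ?_, fun k x j => ?_⟩
  · have := congrFun (congrFun (Matrix.mul_nonsing_inv _ (hu k)) j) i
    rw [Matrix.mul_apply, Matrix.one_apply] at this
    rw [hf]
    simp only [eq_comm (a := i)]
    rw [← this]
    exact Finset.sum_congr rfl fun l _ => mul_comm _ _
  · simp only [hf, Finset.sum_mul]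
    rw [Finset.sum_comm]
    have h1 : ∀ l, ∑ i, (coordMatrix h t k)⁻¹ l i *
        chart (fun k => (0 : Fin (n k + 1))) (t i) k (Fin.castLE (h k) j) =
        if l = j then 1 else 0 := by
      intro l
      have := congrFun (congrFun (Matrix.nonsing_inv_mul _ (hu k)) l) j
      rwa [Matrix.mul_apply, Matrix.one_apply] at this
    have h2 : ∀ l, ∑ i, (coordMatrix h t k)⁻¹ l i * x (Fin.castLE (h k) l) *
        chart (fun k => (0 : Fin (n k + 1))) (t i) k (Fin.castLE (h k) j) =
        x (Fin.castLE (h k) l) * if l = j then 1 else 0 := by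
      intro l
      rw [← h1 l, Finset.mul_sum]
      exact Finset.sum_congr rfl fun i _ => by ring
    simp [h2]

theorem chartForm_sum_smul (c : (k : Fin r) → Fin (n k + 1)) {ι : Type} [Fintype ι] (b : ι → ℂ)
    (v : ι → MultiIndex n d → ℂ) :
    chartForm d c (∑ i, b i • v i) = ∑ i, MvPolynomial.C (b i) * chartForm d c (v i) := by
  simp only [chartForm, Finset.mul_sum]
  rw [Finset.sum_comm]
  refine Finset.sum_congr rfl fun J _ => ?_
  simp only [Finset.sum_apply, Pi.smul_apply, smul_eq_mul, map_sum, map_mul, Finset.sum_mul,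
    mul_assoc]

/-- The discriminant in coordinates on `W` becomes a polynomial on the whole space by composing with
a linear projection onto `W`. -/
theorem exists_discriminant_on (W : Submodule ℂ (MultiIndex n d → ℂ)) :
    ∃ (m : ℕ) (G : MvPolynomial (MultiIndex n d) ℂ), G.IsHomogeneous m ∧
      (∃ a ∈ W, MvPolynomial.eval a G ≠ 0) ∧
      ∀ a ∈ W, ∀ (c : (k : Fin r) → Fin (n k + 1)) (t : ChartIndex c → ℂ),
        (∃ b ∈ W, MvPolynomial.eval t (chartForm d c b) ≠ 0) →
        MvPolynomial.eval t (chartForm d c a) = 0 →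
        (∀ i, MvPolynomial.eval t (MvPolynomial.pderiv i (chartForm d c a)) = 0) →
        MvPolynomial.eval a G = 0 := by
  classical
  let B := Module.finBasis ℂ W
  obtain ⟨m, P, hP, hP0, hPd⟩ := exists_homogeneous_discriminant
    (fun (c : (k : Fin r) → Fin (n k + 1)) (i : Fin (Module.finrank ℂ W)) =>
      chartForm d c (B i : MultiIndex n d → ℂ))
  obtain ⟨π, hπ⟩ := LinearMap.exists_leftInverse_of_injective W.subtype W.ker_subtype
  let L : (MultiIndex n d → ℂ) →ₗ[ℂ] (Fin (Module.finrank ℂ W) → ℂ) :=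
    B.equivFun.toLinearMap ∘ₗ π
  have hLW : ∀ a (ha : a ∈ W), L a = B.equivFun ⟨a, ha⟩ := fun a ha => by
    have := LinearMap.congr_fun hπ ⟨a, ha⟩
    simp only [LinearMap.comp_apply, Submodule.subtype_apply, LinearMap.id_apply] at this
    simp [L, this]
  have hsum : ∀ a ∈ W, a = ∑ i, L a i • (B i : MultiIndex n d → ℂ) := fun a ha => by
    have := congrArg W.subtype (B.sum_equivFun ⟨a, ha⟩)
    rw [map_sum] at this
    rw [hLW a ha]
    exact this.symm
  let G : MvPolynomial (MultiIndex n d) ℂ := MvPolynomial.aeval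
    (fun i => ∑ J, MvPolynomial.C (L (Pi.single J 1) i) * MvPolynomial.X J) P
  have hG : ∀ a, MvPolynomial.eval a G = MvPolynomial.eval (L a) P := by
    intro a
    have hL : ∀ i, L a i = ∑ J, L (Pi.single J 1) i * a J := fun i => by
      conv_lhs => rw [pi_eq_sum_univ' a, map_sum, Finset.sum_apply]
      refine Finset.sum_congr rfl fun J _ => ?_
      rw [map_smul, Pi.smul_apply, smul_eq_mul, mul_comm]
    have : (MvPolynomial.eval a).comp (MvPolynomial.aeval (R := ℂ) (fun i => ∑ J,
        MvPolynomial.C (L (Pi.single J 1) i) * MvPolynomial.X J)).toRingHom =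
        MvPolynomial.eval (L a) := by
      refine MvPolynomial.ringHom_ext (fun c => by simp) fun i => ?_
      simp [hL]
    exact congrArg (fun h : MvPolynomial (Fin (Module.finrank ℂ W)) ℂ →+* ℂ => h P) this
  refine ⟨1 * m, G, hP.aeval _ fun i => MvPolynomial.IsHomogeneous.sum _ _ _ fun J _ =>
    (MvPolynomial.isHomogeneous_X _ _).C_mul _, ?_, fun a ha c t hb h0 h1 => ?_⟩
  · obtain ⟨β, hβ⟩ : ∃ β, MvPolynomial.eval β P ≠ 0 := by
      by_contra! h
      exact hP0 (MvPolynomial.funext fun β => by rw [h, map_zero])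
    refine ⟨B.equivFun.symm β, Submodule.coe_mem _, ?_⟩
    rw [hG, hLW _ (Submodule.coe_mem _)]
    change MvPolynomial.eval (B.equivFun (B.equivFun.symm β)) P ≠ 0
    rwa [LinearEquiv.apply_symm_apply]
  · rw [hG]
    rw [hsum a ha, chartForm_sum_smul] at h0
    have h1' : ∀ i, MvPolynomial.eval t (MvPolynomial.pderiv i
        (∑ j, MvPolynomial.C (L a j) * chartForm d c (B j : MultiIndex n d → ℂ))) = 0 := by
      rw [← chartForm_sum_smul, ← hsum a ha]
      exact h1
    refine hPd c (L a) t ?_ (by simpa using h0) fun s => ?_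
    · obtain ⟨b, hb, hbt⟩ := hb
      by_contra! h
      apply hbt
      rw [hsum b hb, chartForm_sum_smul]
      simp [h]
    · simpa [MvPolynomial.pderiv_C_mul] using h1' s

end

/-! ### Hyperplanes containing the osculating spaces -/

section

variable {r : ℕ} {n : Fin r → ℕ} (d : Fin r → ℕ)

theorem mem_hyperplane_iff {ι : Type} [Fintype ι] (a : ℙ ℂ (ι → ℂ)) (x : ι → ℂ) :
    x ∈ hyperplane a ↔ pairing a.rep x = 0 := by
  rw [pairing_apply]
  rfl

/-- The linear forms that vanish on `T`. -/
def formsVanishingOn {ι : Type} [Fintype ι] (T : Submodule ℂ (ι → ℂ)) : Submodule ℂ (ι → ℂ) where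
  carrier := {a | ∀ x ∈ T, pairing a x = 0}
  add_mem' := by
    intro a b ha hb x hx
    have h1 := ha x hx
    have h2 := hb x hx
    rw [pairing_apply] at *
    simp [add_mul, Finset.sum_add_distrib, h1, h2]
  zero_mem' := by
    intro x _
    simp [pairing_apply]
  smul_mem' := by
    intro c a ha x hx
    have h1 := ha x hx
    rw [pairing_apply] at *
    simp [mul_assoc, ← Finset.mul_sum, h1]

theorem le_hyperplane_iff {ι : Type} [Fintype ι] (T : Submodule ℂ (ι → ℂ)) (a : ℙ ℂ (ι → ℂ)) :
    T ≤ hyperplane a ↔ a.rep ∈ formsVanishingOn T :=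
  forall₂_congr fun x _ => mem_hyperplane_iff a x

variable [∀ k, NeZero (d k)]

/-- The forms with multiplicity at least `δ` at points in general position have no other common
zeros. -/
theorem exists_form_ne_zero [Nontrivial (Fin r)] {N : ℕ} (h : ∀ k, N ≤ n k + 1)
    {t : Fin N → ChartIndex (fun k => (0 : Fin (n k + 1))) → ℂ}
    (ht : ∀ k, (coordMatrix h t k).det ≠ 0) {s : ℕ} (hs : ∀ k, s < d k)
    (c : (k : Fin r) → Fin (n k + 1)) (τ : ChartIndex c → ℂ)
    (hτ : ∀ i, Projectivization.mk ℂ (monomials n d (chart c τ))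
        (monomials_ne_zero n d (chart_ne_zero c τ)) ≠
      Projectivization.mk ℂ (monomials n d (chart _ (t i)))
        (monomials_ne_zero n d (chart_ne_zero _ (t i)))) :
    ∃ b ∈ formsVanishingOn (⨆ i, osculatingSpace (segreVeronese n d) s
      (Projectivization.mk ℂ (monomials n d (chart _ (t i)))
        (monomials_ne_zero n d (chart_ne_zero _ (t i))))),
      MvPolynomial.eval τ (chartForm d c b) ≠ 0 := by
  obtain ⟨f, hf, -⟩ := exists_dual_forms h t ht
  obtain ⟨l, hl, hl0⟩ := exists_separating_forms (fun i => chart _ (t i)) f hf (chart c τ)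
    (chart_ne_zero c τ) (by
      rintro ⟨i, α, hα⟩
      refine hτ i ?_
      rw [Projectivization.mk_eq_mk_iff']
      exact ⟨_, by rw [← monomials_smul, ← funext hα]⟩)
  have hcoef : ∀ k (x : Fin (n k + 1) → ℂ), ∑ j, l k (Pi.single j 1) * x j = l k x := by
    intro k x
    conv_rhs => rw [pi_eq_sum_univ' x, map_sum]
    exact Finset.sum_congr rfl fun j _ => by rw [map_smul, smul_eq_mul, mul_comm]
  -- The form `∏ l k ^ d k`; any factor vanishing at a point suffices there, since `s < d k` for all
  -- `k`.
  refine ⟨formCoeff n d fun k _ j => l k (Pi.single j 1), ?_, ?_⟩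
  · have hle : (⨆ i, osculatingSpace (segreVeronese n d) s
      (Projectivization.mk ℂ (monomials n d (chart _ (t i)))
        (monomials_ne_zero n d (chart_ne_zero _ (t i))))) ≤
        LinearMap.ker (pairing (formCoeff n d fun k _ j => l k (Pi.single j 1))).toLinearMap := by
      refine iSup_le fun i => ?_
      obtain ⟨k, hk⟩ := hl0 i
      exact pairing_formCoeff_eq_zero d _ (t i) (fun k j => l k (Pi.single j 1)) k
        (by rw [hcoef]; exact hk) s (hs k)
    exact fun x hx => hle hx
  · rw [eval_chartForm, sum_formCoeff_mul_monomials]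
    simp only [hcoef]
    exact Finset.prod_ne_zero_iff.mpr fun k _ => Finset.prod_ne_zero_iff.mpr fun _ _ => hl k

theorem holdsGenerally_not_tangent [Nontrivial (Fin r)] {N : ℕ} (h : ∀ k, N ≤ n k + 1)
    {p : Fin N → ℙ ℂ (MultiIndex n d → ℂ)} (hp : InGeneralPosition d h p) {s : ℕ}
    (hs : ∀ k, s < d k) :
    HoldsGenerally (zariski (MultiIndex n d))
      {a | (⨆ i, osculatingSpace (segreVeronese n d) s (p i)) ≤ hyperplane a}
      (fun a => ¬ IsTangentAlongPosDim (segreVeronese n d) (hyperplane a)) := by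
  obtain ⟨t, hpt, ht⟩ := hp
  obtain rfl := funext hpt
  simp only [le_hyperplane_iff]
  set W := formsVanishingOn (⨆ i, osculatingSpace (segreVeronese n d) s
    (Projectivization.mk ℂ (monomials n d (chart _ (t i)))
      (monomials_ne_zero n d (chart_ne_zero _ (t i))))) with hW
  obtain ⟨m, G, hG, ⟨a₀, ha₀, ha₀G⟩, hdisc⟩ := exists_discriminant_on d W
  refine ⟨{q | MvPolynomial.eval q.rep G ≠ 0},
    TopologicalSpace.isOpen_generateFrom_of_mem ⟨m, G, hG, rfl⟩,
    linear_subset_closure W hG ha₀ ha₀G, ?_⟩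
  rintro a ⟨haG, haW⟩ ⟨Y, hYX, -, -, hdim, htan⟩
  -- Outside the points `p i` the system has no base point, so the discriminant forbids tangency
  -- there and `Y` is finite.
  refine absurd hdim (not_lt.mpr (topologicalKrullDim_zariski_finite
    ((Set.finite_range fun i => Projectivization.mk ℂ (monomials n d (chart _ (t i)))
      (monomials_ne_zero n d (chart_ne_zero _ (t i)))).subset fun y hy => ?_)))
  obtain ⟨c, τ, rfl⟩ := exists_chart_eq d (hYX hy)
  by_contra hmem
  obtain ⟨h0, h1⟩ := chartForm_singular_of_osculatingSpace_le d c τ a (htan _ hy)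
  exact haG (hdisc _ haW c τ (exists_form_ne_zero d h ht hs c τ fun i hi => hmem ⟨i, hi.symm⟩) h0 h1)

/-- In a single projective space, no form of degree `d` has multiplicity `d` at a full set of points
in general position. -/
theorem formsVanishingOn_eq_bot [NeZero r] [Subsingleton (Fin r)] (h : ∀ k, n 0 + 1 ≤ n k + 1)
    {p : Fin (n 0 + 1) → ℙ ℂ (MultiIndex n d → ℂ)} (hp : InGeneralPosition d h p) {s : ℕ}
    (hs : d 0 ≤ s + 1) :
    formsVanishingOn (⨆ i, osculatingSpace (segreVeronese n d) s (p i)) = ⊥ := by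
  obtain ⟨t, hpt, ht⟩ := hp
  obtain ⟨f, -, hf⟩ := exists_dual_forms h t ht
  refine (Submodule.eq_bot_iff _).mpr fun a ha => ?_
  refine eq_zero_of_pairing_partialDeriv_eq_zero d (NeZero.ne _) (fun i => _) t ?_ a
    fun i k hk j => ha _ ?_
  · refine eq_top_iff.mpr fun x _ => ?_
    -- With `N = n 0 + 1` the matrix involves all coordinates, so the points span.
    have hx : x = ∑ i, f 0 i (x 0) • chart (fun k => (0 : Fin (n k + 1))) (t i) := by
      ext k j
      obtain rfl := Subsingleton.elim 0 k
      rw [Finset.sum_apply, Finset.sum_apply]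
      exact (hf 0 (x 0) j).symm
    rw [hx]
    exact Submodule.sum_mem _ fun i _ => Submodule.smul_mem _ _ (Submodule.subset_span ⟨i, rfl⟩)
  · refine Submodule.mem_iSup_of_mem i ?_
    rw [hpt i]
    exact partialDeriv_chartMap_mem_osculatingSpace d _ (t i) (by omega) j

theorem HoldsGenerally.mono {α : Type} {τ : TopologicalSpace α} {Y : Set α} {P Q : α → Prop}
    (h : HoldsGenerally τ Y P) (hPQ : ∀ y, P y → Q y) : HoldsGenerally τ Y Q := by
  obtain ⟨U, hU, hY, hP⟩ := h
  exact ⟨U, hU, hY, fun y hy => hPQ y (hP y hy)⟩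

end

end SegreVeronese

end

theorem mainTheorem8 {r : ℕ} [NeZero r] (n d : Fin r → ℕ)
    (hn : ∀ k, 1 ≤ n k) (hmono : Monotone n)
    (δ : ℕ) (hδ : IsLeast (Set.range d) δ) (hδ2 : 2 ≤ δ) :
    SegreVeronese.HoldsGenerally
      (SegreVeronese.zariskiProd (Fin (n 0 + 1)) (SegreVeronese.MultiIndex n d))
      {p | ∀ i, p i ∈ SegreVeronese.segreVeronese n d}
      (fun p =>
        SegreVeronese.HoldsGenerally
          (SegreVeronese.zariski (SegreVeronese.MultiIndex n d))
          {a | (⨆ i, SegreVeronese.osculatingSpace (SegreVeronese.segreVeronese n d) (δ - 1) (p i))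
            ≤ SegreVeronese.hyperplane a}
          (fun a => ¬ SegreVeronese.IsTangentAlongPosDim (SegreVeronese.segreVeronese n d)
            (SegreVeronese.hyperplane a))) := by
  have hd : ∀ k, δ ≤ d k := fun k => hδ.2 ⟨k, rfl⟩
  have : ∀ k, NeZero (d k) := fun k => ⟨by have := hd k; omega⟩
  have h : ∀ k, n 0 + 1 ≤ n k + 1 := fun k => Nat.succ_le_succ (hmono (Fin.zero_le k))
  refine (SegreVeronese.holdsGenerally_inGeneralPosition d h).mono fun p hp => ?_
  rcases subsingleton_or_nontrivial (Fin r) with hr | hr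
  · obtain ⟨k, hk⟩ := hδ.1
    obtain rfl := Subsingleton.elim 0 k
    have hbot := SegreVeronese.formsVanishingOn_eq_bot d h hp (s := δ - 1) (by omega)
    -- No hyperplane contains `T`, so the empty set is dense in the set of such hyperplanes.
    refine ⟨∅, @isOpen_empty _ (SegreVeronese.zariski _), fun a ha => ?_, fun a ha => ha.1.elim⟩
    have h1 := (SegreVeronese.le_hyperplane_iff _ a).mp ha
    rw [hbot, Submodule.mem_bot] at h1
    exact (a.rep_nonzero h1).elim
  · exact SegreVeronese.holdsGenerally_not_tangent d h hp fun k => by have := hd k; omega
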